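/- **Setting.** Let $N\ge 1$, $n\ge 1$. Let $A(x,y)=(A_{ij}(x,y))$ and $c(x,y)$ be real coefficients, $A_{ij},c\in C_b(\mathbb R^N;L^\infty(\mathbb T^N))$, with $A$ symmetric and uniformly coercive ($\alpha|\xi|^2\le A(x,y)\xi\cdot\xi$ for some $\alpha>0$). For $(x,\theta)\in\mathbb R^N\times\mathbb R^N$ let $\lambda_1(x,\theta)\le\lambda_2(x,\theta)\le\dots$ be the eigenvalues, repeated with multiplicity, of the cell problem $$-(\mathrm{div}_y+2i\pi\theta)\big(A(x,y)(\nabla_y+2i\pi\theta)\psi\big)+c(x,y)\psi=\lambda\,\psi\quad\text{in }\mathbb T^N,\qquad \psi\in H^1(\mathbb T^N).$$ Let $(x^n,\theta^n)$ be a point such that $\lambda_n(x^n,\theta^n)$ is a simple eigenvalue, $\nabla_x\lambda_n(x^n,\theta^n)=\nabla_\theta\lambda_n(x^n,\theta^n)=0$, and $A,c$ are of class $C^2$ in $x$ near $x^n$, as maps with values in $L^\infty(\mathbb T^N)$. Let $x\mapsto\psi_n(x,\cdot)\in L^2(\mathbb T^N)$, for $x$ near $x^n$, be eigenfunctions for $\lambda_n(x,\theta^n)$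 with $L^2$ norm $1$, differentiable at $x=x^n$. At the point $(x^n,\theta^n)$ put $$A^*=\tfrac1{8\pi^2}\nabla_\theta\nabla_\theta\lambda_n,\quad B^*=\tfrac1{2i\pi}\nabla_\theta\nabla_x\lambda_n\ \Big(B^*_{kh}=\tfrac1{2i\pi}\tfrac{\partial^2\lambda_n}{\partial\theta_k\partial x_h}\Big),\quad D^*=\tfrac12\nabla_x\nabla_x\lambda_n,$$ $$c^*=\sum_k\int_{\mathbb T^N}\Big[A(\nabla_y+2i\pi\theta^n)\psi_n\cdot\tfrac{\partial\bar\psi_n}{\partial x_k}e_k-A(\nabla_y-2i\pi\theta^n)\tfrac{\partial\bar\psi_n}{\partial x_k}\cdot\psi_n e_k-\tfrac{\partial A}{\partial x_k}(\nabla_y-2i\pi\theta^n)\bar\psi_n\cdot\psi_n e_k\Big]dy,$$ and let $\mathbb A^*$ be the unbounded operator on $L^2(\mathbb R^N)$ (complex valued functions) $$\mathbb A^*\varphi=-\mathrm{div}(A^*\nabla\varphi)+\mathrm{div}(\varphi B^*z)+c^*\varphi+(D^*z\cdot z)\,\varphi,$$ with domain $\{\varphi\in H^1(\mathbb R^N):\mathbb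 A^*\varphi\in L^2(\mathbb R^N)\}$, derivatives being taken in the sense of distributions. **Proposition 3.5 (label localization).** Assume that the full $2N\times 2N$ Hessian matrix $\nabla\nabla\lambda_n$ in the variables $(x,\theta)$ is (symmetric and) positive definite at $(x^n,\theta^n)$. Then: 1. $\mathbb A^*$ has compact resolvent (its resolvent set is non-empty and $(\mathbb A^*-\mu)^{-1}$ is compact for every $\mu$ in it); 2. $L^2(\mathbb R^N)$ has an orthonormal basis $(\varphi_k)_{k\in\mathbb N}$ (a Hilbert basis) that consists of eigenfunctions of $\mathbb A^*$; 3. for every eigenfunction $\varphi$ of $\mathbb A^*$, in particular for every $\varphi_k$, there is a real $\gamma>0$ with $e^{\gamma|z|}\varphi\in L^2(\mathbb R^N)$ and $e^{\gamma|z|}\nabla\varphi\in L^2(\mathbb R^N)^N$. -/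

import Mathlib

open MeasureTheory Filter Topology Real
open scoped ENNReal ContDiff ComplexConjugate BoundedContinuousFunction

noncomputable section

/-- `ℝ^N` with its Euclidean norm. -/
abbrev RN (N : ℕ) : Type := EuclideanSpace ℝ (Fin N)

/-- `L²(ℝ^N)`, complex valued. -/
abbrev L2Space (N : ℕ) : Type := Lp ℂ 2 (volume : Measure (RN N))

/-- `L²(𝕋^N)`, complex valued. -/
abbrev L2Torus (N : ℕ) : Type := Lp ℂ 2 (volume : Measure (UnitAddTorus (Fin N)))

/-- `L^∞(𝕋^N)`, real valued. -/
abbrev LInfTorus (N : ℕ) : Type := Lp ℝ ∞ (volume : Measure (UnitAddTorus (Fin N)))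

/-- The `j`-th vector of the canonical basis of `ℝ^N`. -/
def stdVec {N : ℕ} (j : Fin N) : RN N := EuclideanSpace.single j (1 : ℝ)

/-! ### The Bloch cell problem on the torus -/

/-- `g = ∂u/∂y_j` in the sense of distributions on the torus: integration by parts holds against
all the characters `y ↦ exp (2iπ m · y)`, which span a dense subspace of the smooth functions. -/
def IsTorusDeriv {N : ℕ} (j : Fin N) (u g : L2Torus N) : Prop :=
  ∀ m : Fin N → ℤ,
    ∫ y, g y * UnitAddTorus.mFourier m y =
      -∫ y, u y * (2 * π * Complex.I * (m j : ℂ) * UnitAddTorus.mFourier m y)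

/-- Membership in the periodic Sobolev space `H¹(𝕋^N)`. -/
def MemTorusH1 {N : ℕ} (u : L2Torus N) : Prop :=
  ∀ j : Fin N, ∃ g : L2Torus N, IsTorusDeriv j u g

open Classical in
/-- The weak derivative `∂u/∂y_j` (used for `u ∈ H¹(𝕋^N)` only). -/
def torusPartial {N : ℕ} (j : Fin N) (u : L2Torus N) : L2Torus N :=
  if h : ∃ g : L2Torus N, IsTorusDeriv j u g then h.choose else 0

/-- The `j`-th component of `(∇_y + 2iπθ) u`. -/
def twistedPartial {N : ℕ} (θ : RN N) (j : Fin N) (u : L2Torus N) : L2Torus N :=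
  torusPartial j u + (2 * π * Complex.I * (θ j : ℂ)) • u

/-- Real coefficients `A(x,y)`, `c(x,y)` in `C_b(ℝ^N; L^∞(𝕋^N))`, with `A` symmetric and uniformly
coercive. -/
structure CellCoefficients (N : ℕ) where
  /-- the entries `A_{ij}` of the tensor -/
  A : Fin N → Fin N → (RN N →ᵇ LInfTorus N)
  /-- the zero-order coefficient -/
  c : RN N →ᵇ LInfTorus N
  symm : ∀ i j, A i j = A j i
  coercive : ∃ α : ℝ, 0 < α ∧ ∀ x : RN N, ∀ᵐ y : UnitAddTorus (Fin N), ∀ ξ : Fin N → ℝ,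
    α * ∑ i, ξ i ^ 2 ≤ ∑ i, ∑ j, A i j x y * ξ i * ξ j

namespace CellCoefficients

variable {N : ℕ} (K : CellCoefficients N)

/-- `ψ` is an eigenfunction, with eigenvalue `μ`, of the Bloch cell operator at `(x,θ)`:
`-(div_y + 2iπθ)(A(x,y)(∇_y + 2iπθ)ψ) + c(x,y) ψ = μ ψ` in `𝕋^N`, in the variational sense. -/
def IsBlochEigenfunction (x θ : RN N) (μ : ℝ) (ψ : L2Torus N) : Prop :=
  ψ ≠ 0 ∧ MemTorusH1 ψ ∧ ∀ η : L2Torus N, MemTorusH1 η →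
    ∫ y, ((∑ i, ∑ j, (K.A i j x y : ℂ) * twistedPartial θ j ψ y * conj (twistedPartial θ i η y))
        + (K.c x y : ℂ) * ψ y * conj (η y)) =
      (μ : ℂ) * ∫ y, ψ y * conj (η y)

/-- The `n`-th Bloch eigenvalue `λ_n(x,θ)`, `n ≥ 1`: the eigenvalues of the cell problem in
increasing order, repeated with their multiplicity. It is the least `t` such that there are at
least `n` linearly independent eigenfunctions with eigenvalues at most `t`. -/
def blochEigenvalue (n : ℕ) (x θ : RN N) : ℝ :=
  sInf {t : ℝ | (n : Cardinal) ≤ Module.rank ℂ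
    (Submodule.span ℂ {ψ : L2Torus N | ∃ μ : ℝ, μ ≤ t ∧ K.IsBlochEigenfunction x θ μ ψ})}

/-- `λ_n(x,θ)` is a simple eigenvalue. -/
def IsSimpleAt (n : ℕ) (x θ : RN N) : Prop :=
  Module.finrank ℂ (Submodule.span ℂ
    {ψ : L2Torus N | K.IsBlochEigenfunction x θ (K.blochEigenvalue n x θ) ψ}) = 1

/-- `λ_n` as a function on the phase space of the pairs `(x,θ)`. -/
def blochBand (n : ℕ) (p : RN N × RN N) : ℝ := K.blochEigenvalue n p.1 p.2

/-- The coordinate directions of phase space: first those of `x`, then those of `θ`. -/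
def phaseVec : Fin N ⊕ Fin N → RN N × RN N :=
  Sum.elim (fun i => (stdVec i, 0)) (fun i => (0, stdVec i))

/-- The full Hessian matrix `∇∇λ_n` in the variables `(x,θ)` at the point `(x,θ)`. -/
def blochHessian (n : ℕ) (x θ : RN N) : Matrix (Fin N ⊕ Fin N) (Fin N ⊕ Fin N) ℝ :=
  Matrix.of fun a b =>
    fderiv ℝ (fderiv ℝ (K.blochBand n)) (x, θ) (phaseVec a) (phaseVec b)

/-- `A* = (1/8π²) ∇_θ∇_θ λ_n`. -/
def Astar (n : ℕ) (x θ : RN N) : Matrix (Fin N) (Fin N) ℝ :=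
  (1 / (8 * π ^ 2)) • (K.blochHessian n x θ).toBlocks₂₂

/-- `B* = (1/2iπ) ∇_θ∇_x λ_n`: the row index belongs to `θ`, the column index to `x`. -/
def Bstar (n : ℕ) (x θ : RN N) : Matrix (Fin N) (Fin N) ℂ :=
  (1 / (2 * Complex.I * π)) • (K.blochHessian n x θ).toBlocks₂₁.map Complex.ofReal

/-- `D* = (1/2) ∇_x∇_x λ_n`. -/
def Dstar (n : ℕ) (x θ : RN N) : Matrix (Fin N) (Fin N) ℝ :=
  (1 / 2 : ℝ) • (K.blochHessian n x θ).toBlocks₁₁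

/-- `x' ↦ ψ x'` is a branch, differentiable at `x`, of normalized eigenfunctions
`ψ_n(x', ·, θ)` of the cell problem for `x'` near `x`. -/
def IsBlochBranch (n : ℕ) (x θ : RN N) (ψ : RN N → L2Torus N) : Prop :=
  DifferentiableAt ℝ ψ x ∧
    ∀ᶠ x' in 𝓝 x, K.IsBlochEigenfunction x' θ (K.blochEigenvalue n x' θ) (ψ x') ∧ ‖ψ x'‖ = 1

/-- `c* = ∫ [A(∇_y+2iπθ)ψ·(∂ψ̄/∂x_k)e_k - A(∇_y-2iπθ)(∂ψ̄/∂x_k)·ψ e_k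
  - (∂A/∂x_k)(∇_y-2iπθ)ψ̄·ψ e_k] dy`, with summation over `k`, at the point `(x,θ)`. -/
def cstar (x θ : RN N) (ψ : RN N → L2Torus N) : ℂ :=
  ∫ y, ∑ k, ∑ j,
    ((K.A k j x y : ℂ) * twistedPartial θ j (ψ x) y * conj (fderiv ℝ ψ x (stdVec k) y)
      - (K.A k j x y : ℂ) * conj (twistedPartial θ j (fderiv ℝ ψ x (stdVec k)) y) * ψ x y
      - (fderiv ℝ (K.A k j) x (stdVec k) y : ℂ) * conj (twistedPartial θ j (ψ x) y) * ψ x y)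

end CellCoefficients

/-! ### The homogenized operator on `L²(ℝ^N)` -/

/-- `g` is the weak gradient `∇φ` of `φ`, and it is square integrable. -/
def IsWeakGradient {N : ℕ} (φ : L2Space N) (g : Fin N → L2Space N) : Prop :=
  ∀ j : Fin N, ∀ η : RN N → ℂ, ContDiff ℝ ∞ η → HasCompactSupport η →
    ∫ z, g j z * η z = -∫ z, φ z * fderiv ℝ η z (stdVec j)

/-- The graph of the unbounded operator `𝔸*` of `L²(ℝ^N)` given by
`𝔸*φ = -div(A∇φ) + div(φ B z) + c φ + (D z · z) φ`
with domain `{φ ∈ H¹(ℝ^N) : 𝔸*φ ∈ L²(ℝ^N)}`, the derivatives being those of distributions: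
`HomogenizedOp A B c D φ f` says that `φ` lies in the domain and that `𝔸*φ = f`. -/
def HomogenizedOp {N : ℕ} (A : Matrix (Fin N) (Fin N) ℝ) (B : Matrix (Fin N) (Fin N) ℂ) (c : ℂ)
    (D : Matrix (Fin N) (Fin N) ℝ) (φ f : L2Space N) : Prop :=
  ∃ g : Fin N → L2Space N, IsWeakGradient φ g ∧
    ∀ η : RN N → ℂ, ContDiff ℝ ∞ η → HasCompactSupport η →
      ∫ z, ((∑ j, ∑ k, (A j k : ℂ) * g k z * fderiv ℝ η z (stdVec j))
          - (∑ j, ∑ k, φ z * (B j k * (z k : ℂ)) * fderiv ℝ η z (stdVec j))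
          + c * φ z * η z
          + (∑ j, ∑ k, (D j k : ℂ) * (z k : ℂ) * (z j : ℂ)) * φ z * η z) =
        ∫ z, f z * η z

/-- For the graph `T` of an unbounded operator: `μ` lies in the resolvent set, and the bounded
operator `R` is the resolvent `(T - μ)⁻¹`. -/
def IsResolventAt {H : Type*} [NormedAddCommGroup H] [NormedSpace ℂ H] (T : H → H → Prop) (μ : ℂ)
    (R : H →L[ℂ] H) : Prop :=
  ∀ f φ : H, R f = φ ↔ T φ (f + μ • φ)

/-- The unbounded operator with graph `T` has compact resolvent: its resolvent set is not empty,
and all its resolvents are compact. -/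
def HasCompactResolvent {H : Type*} [NormedAddCommGroup H] [NormedSpace ℂ H]
    (T : H → H → Prop) : Prop :=
  (∃ μ : ℂ, ∃ R : H →L[ℂ] H, IsResolventAt T μ R) ∧
    ∀ (μ : ℂ) (R : H →L[ℂ] H), IsResolventAt T μ R → IsCompactOperator R

/-- `φ` is an eigenfunction, with eigenvalue `σ`, of the unbounded operator with graph `T`. -/
def IsEigenfunctionOf {H : Type*} [NormedAddCommGroup H] [NormedSpace ℂ H] (T : H → H → Prop)
    (σ : ℂ) (φ : H) : Prop :=
  φ ≠ 0 ∧ T φ (σ • φ)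

end

noncomputable section

variable {N : ℕ}

/-! ### Convolution of `L²` functions with test functions -/

/-! Let `M` be half the Hessian in the variables (x, 2πθ), and let P = (z, -i∇) act on functions of
z. Up to a scalar, the homogenized operator is the Weyl quantization of the quadratic form M:
symmetrizing z_k(-i∂_j) gives 𝔸* = P·MP + c - i tr M₂₁, where M₂₁ is the (θ, x) block. The first
term is a nonnegative self-adjoint operator of harmonic oscillator type, and the complex scalar
changes neither the domain nor the eigenfunctions. This is why an orthonormal eigenbasis exists
although `c` may be any complex number.

Factor M = SᵀS with S invertible and S' = S⁻¹. The form of P·MP + 1 is ‖φ‖² + ‖S Pφ‖², so φ ↦ (φ, S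
Pφ) identifies the form domain with a closed subspace V of a power of L² (`formDomain`), with the
form as inner product. If i : V → L² is the inclusion, the Riesz representation gives (P·MP + 1)⁻¹ =
i i† (`homogenizedOp_formResolvent`), which is symmetric by construction. It is compact because i
is: on V both ∇φ and zφ are controlled, so mollification followed by truncation to a ball
approximates i in operator norm by operators with square integrable kernel
(`isCompactOperator_of_bounds`). The spectral theorem for compact symmetric operators then yields
the basis.

The prescribed domain only requires φ ∈ H¹ and 𝔸*φ ∈ L², so it is not clear at first that such a φ
lies in V. Uniqueness for the resolvent equation, as well as decay, therefore comes from a localized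
energy inequality (`energy_le`), obtained by testing with W²φ̄ for a compactly supported weight W.
The symbol is coercive in (zφ, ∇φ), and the commutator of W with the B term is purely imaginary
because B is, so only ∇W·A∇φ has to be absorbed. With plain cutoffs this gives uniqueness
(`eq_zero_of_re_lt`). With nearly Gaussian weights the confinement κ|z|² dominates the loss |∇W|²,
and a Gaussian bound follows, which is stronger than the exponential one
(`exists_exponential_decay`). -/

theorem memLp_two_of_test {η : RN N → ℂ} (hη : Continuous η) (hc : HasCompactSupport η) :
    MemLp η 2 (volume : Measure (RN N)) :=
  hη.memLp_of_hasCompactSupport hc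

theorem MeasureTheory.MemLp.integrable_fun_mul {f g : RN N → ℂ} (hf : MemLp f 2 volume)
    (hg : MemLp g 2 volume) : Integrable (fun x => f x * g x) volume :=
  hf.integrable_mul hg

theorem norm_integral_mul_le {f g : RN N → ℂ} (hf : MemLp f 2 volume) (hg : MemLp g 2 volume) :
    ‖∫ x, f x * g x‖ ≤ (eLpNorm f 2 volume).toReal * (eLpNorm g 2 volume).toReal := by
  have h1 : ∫ x, f x * g x = inner ℂ (hf.star.toLp _) (hg.toLp g) := by
    rw [L2.inner_def]
    refine integral_congr_ae ?_
    filter_upwards [hf.star.coeFn_toLp, hg.coeFn_toLp] with x h1 h2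
    rw [h1, h2]
    simp [mul_comm]
  rw [h1]
  refine (norm_inner_le_norm _ _).trans (le_of_eq ?_)
  rw [Lp.norm_toLp, Lp.norm_toLp]
  congr 2
  exact eLpNorm_congr_norm_ae (by simp)

/-- Convolution `x ↦ ∫ u(t) η(x - t) dt`. -/
def conv (u η : RN N → ℂ) : RN N → ℂ :=
  convolution u η (ContinuousLinearMap.mul ℝ ℂ) volume

theorem conv_apply (u η : RN N → ℂ) (x : RN N) : conv u η x = ∫ t, u t * η (x - t) := rfl

theorem L2Space.locallyIntegrable (u : L2Space N) : LocallyIntegrable u volume :=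
  (Lp.memLp u).locallyIntegrable (by norm_num)

theorem conv_contDiff (u : L2Space N) {η : RN N → ℂ} (hη : ContDiff ℝ ∞ η)
    (hc : HasCompactSupport η) : ContDiff ℝ ∞ (conv u η) :=
  hc.contDiff_convolution_right (n := ⊤) _ u.locallyIntegrable hη

theorem HasCompactSupport.comp_sub_left {η : RN N → ℂ} (hc : HasCompactSupport η) (x : RN N) :
    HasCompactSupport (fun t => η (x - t)) :=
  hc.comp_homeomorph (Homeomorph.subLeft x)

theorem fderiv_comp_sub_left {η : RN N → ℂ} (hη : ContDiff ℝ ∞ η) (x t v : RN N) :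
    fderiv ℝ (fun s => η (x - s)) t v = - fderiv ℝ η (x - t) v := by
  have h : HasFDerivAt (fun s => η (x - s))
      ((fderiv ℝ η (x - t)).comp (-ContinuousLinearMap.id ℝ (RN N))) t := by
    have h1 : HasFDerivAt η (fderiv ℝ η (x - t)) (x - t) :=
      (hη.differentiable (by simp)).differentiableAt.hasFDerivAt
    exact h1.comp t ((hasFDerivAt_id t).const_sub x)
  rw [h.fderiv]; simp

/-- The reflected translate `t ↦ η (x - t)` is itself a test function. The sign produced by its
chain rule cancels the sign in the definition of the weak gradient. -/
theorem fderiv_conv_stdVec {u : L2Space N} {g : Fin N → L2Space N} (hg : IsWeakGradient u g)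
    {η : RN N → ℂ} (hη : ContDiff ℝ ∞ η) (hc : HasCompactSupport η) (x : RN N) (j : Fin N) :
    fderiv ℝ (conv u η) x (stdVec j) = conv (g j) η x := by
  have h1 := hc.hasFDerivAt_convolution_right (μ := volume) (ContinuousLinearMap.mul ℝ ℂ)
    u.locallyIntegrable (hη.of_le (by exact_mod_cast le_top)) x
  unfold conv
  rw [h1.fderiv, convolution_precompR_apply _ u.locallyIntegrable (hc.fderiv ℝ)
    (hη.continuous_fderiv (by simp))]
  have h2 := hg j (fun t => η (x - t)) (hη.comp (contDiff_const.sub contDiff_id))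
    (hc.comp_sub_left x)
  simp only [convolution_def, ContinuousLinearMap.mul_apply']
  rw [h2, ← integral_neg]
  refine integral_congr_ae (Eventually.of_forall fun t => ?_)
  simp only [fderiv_comp_sub_left hη]
  ring

/-! ### Translations and mollification -/

/-- Translation `x ↦ u(x - h)`, as a function. -/
def shiftFun (h : RN N) (u : RN N → ℂ) : RN N → ℂ := fun x => u (x - h)

theorem memLp_shiftFun (h : RN N) (u : L2Space N) : MemLp (shiftFun h u) 2 volume :=
  (Lp.memLp u).comp_measurePreserving (measurePreserving_sub_right volume h)

theorem exists_continuous_shift (u : L2Space N) : ∃ F : RN N → L2Space N, Continuous F ∧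
    ∀ h, F h =ᵐ[volume] shiftFun h u := by
  let g : RN N → C(RN N, RN N) := fun h => ⟨fun x => x - h, by fun_prop⟩
  have hg : Continuous g :=
    ContinuousMap.continuous_of_continuous_uncurry _ (by
      show Continuous fun p : RN N × RN N => p.2 - p.1
      fun_prop)
  have hgm : ∀ h, MeasurePreserving (g h) volume volume :=
    fun h => measurePreserving_sub_right volume h
  exact ⟨fun h => Lp.compMeasurePreserving (g h) (hgm h) u,
    (continuous_const (y := u)).compMeasurePreservingLp hg hgm (by norm_num),
    fun h => Lp.coeFn_compMeasurePreserving u (hgm h)⟩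

theorem tendsto_shiftFun_sub (u : L2Space N) :
    Tendsto (fun h : RN N => eLpNorm (shiftFun h u - ⇑u) 2 volume) (𝓝 0) (𝓝 0) := by
  obtain ⟨F, hF, hFu⟩ := exists_continuous_shift u
  have h0 : F 0 = u := by
    ext1
    filter_upwards [hFu 0] with x hx
    rw [hx]; simp [shiftFun]
  have h1 := tendsto_iff_edist_tendsto_0.1 (hF.tendsto 0)
  refine h1.congr fun h => ?_
  rw [h0, Lp.edist_def]
  refine eLpNorm_congr_ae ?_
  filter_upwards [hFu h] with x hx
  rw [Pi.sub_apply, Pi.sub_apply, hx]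

/-- Each partial derivative is a convolution with `g j`, to which the Cauchy-Schwarz inequality
applies. The resulting Lipschitz bound depends on `η` only through its L² norm, as the duality
argument for translations requires. -/
theorem norm_fderiv_conv_le {u : L2Space N} {g : Fin N → L2Space N} (hg : IsWeakGradient u g)
    {η : RN N → ℂ} (hη : ContDiff ℝ ∞ η) (hc : HasCompactSupport η) (x : RN N) :
    ‖fderiv ℝ (conv u η) x‖ ≤ (∑ j, ‖g j‖) * (eLpNorm η 2 volume).toReal := by
  refine ContinuousLinearMap.opNorm_le_bound _ (by positivity) fun v => ?_
  have hv : v = ∑ j, v j • stdVec j := by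
    ext i
    simp [stdVec, Pi.single_apply]
  have hm : ∀ j, ‖conv (g j) η x‖ ≤ ‖g j‖ * (eLpNorm η 2 volume).toReal := by
    intro j
    rw [conv_apply]
    have h1 : MemLp (fun t => η (x - t)) 2 volume :=
      memLp_two_of_test (hη.continuous.comp (by fun_prop)) (hc.comp_sub_left x)
    refine (norm_integral_mul_le (Lp.memLp (g j)) h1).trans (le_of_eq ?_)
    rw [Lp.norm_def]
    congr 2
    exact eLpNorm_comp_measurePreserving (p := 2) hη.continuous.aestronglyMeasurable
      (Measure.measurePreserving_sub_left volume x)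
  conv_lhs => rw [hv, map_sum]
  simp only [map_smul, fderiv_conv_stdVec hg hη hc]
  calc ‖∑ j, v j • conv (g j) η x‖ ≤ ∑ j, ‖v j • conv (g j) η x‖ := norm_sum_le _ _
    _ ≤ ∑ j, ‖g j‖ * (eLpNorm η 2 volume).toReal * ‖v‖ := by
        refine Finset.sum_le_sum fun j _ => ?_
        rw [norm_smul, mul_comm]
        gcongr
        · exact hm j
        · exact PiLp.norm_apply_le v j
    _ = _ := by rw [Finset.sum_mul, Finset.sum_mul]

/-- An `L²` function is bounded in norm by its pairings with test functions. -/
theorem norm_le_of_forall_test {f : L2Space N} {C : ℝ} (hC : 0 ≤ C)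
    (h : ∀ η : RN N → ℂ, ContDiff ℝ ∞ η → HasCompactSupport η →
      ‖∫ x, f x * η x‖ ≤ C * (eLpNorm η 2 volume).toReal) : ‖f‖ ≤ C := by
  let P : Submodule ℂ (L2Space N) :=
    { carrier := {w | ∃ η : RN N → ℂ, ContDiff ℝ ∞ η ∧ HasCompactSupport η ∧ w =ᵐ[volume] η}
      zero_mem' := ⟨0, contDiff_const, HasCompactSupport.zero, Lp.coeFn_zero _ _ _⟩
      add_mem' := by
        rintro a b ⟨η, h1, h2, h3⟩ ⟨η', h1', h2', h3'⟩
        exact ⟨η + η', h1.add h1', h2.add h2', (Lp.coeFn_add a b).trans (h3.add h3')⟩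
      smul_mem' := by
        rintro c a ⟨η, h1, h2, h3⟩
        exact ⟨c • η, h1.const_smul c, h2.smul_left (f := fun _ => c),
          (Lp.coeFn_smul c a).trans (h3.const_smul c)⟩ }
  have hP : P.topologicalClosure = ⊤ := by
    rw [Submodule.topologicalClosure_eq_top_iff, Submodule.eq_bot_iff]
    intro w hw
    rw [Submodule.mem_orthogonal'] at hw
    rw [Lp.eq_zero_iff_ae_eq_zero]
    -- Density by duality: a function orthogonal to all test functions, in particular to the real
    -- ones, vanishes almost everywhere.
    refine ae_eq_zero_of_integral_contDiff_smul_eq_zero w.locallyIntegrable fun η h1 h2 => ?_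
    have hη : ContDiff ℝ ∞ fun x => (η x : ℂ) := Complex.ofRealCLM.contDiff.comp h1
    have hc : HasCompactSupport fun x => (η x : ℂ) := h2.comp_left Complex.ofReal_zero
    have hm := memLp_two_of_test hη.continuous hc
    have h3 := hw (hm.toLp _) ⟨_, hη, hc, hm.coeFn_toLp⟩
    rw [L2.inner_def] at h3
    rw [← map_eq_zero (starRingEnd ℂ), ← integral_conj, ← h3]
    refine integral_congr_ae ?_
    filter_upwards [hm.coeFn_toLp] with x hx
    rw [hx]
    simp
  have key : ∀ w : L2Space N, ‖(inner ℂ f w : ℂ)‖ ≤ C * ‖w‖ := by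
    intro w
    have hcl : IsClosed {w : L2Space N | ‖(inner ℂ f w : ℂ)‖ ≤ C * ‖w‖} :=
      isClosed_le (by fun_prop) (by fun_prop)
    have hw : w ∈ P.topologicalClosure := by rw [hP]; trivial
    refine (closure_minimal (s := (P : Set (L2Space N))) ?_ hcl) hw
    rintro w ⟨η, h1, h2, h3⟩
    have h4 := h (fun x => conj (η x)) (Complex.conjCLE.contDiff.comp h1)
      (h2.comp_left (map_zero _))
    have h5 : ∫ x, f x * conj (η x) = conj (inner ℂ f w) := by
      rw [L2.inner_def, ← integral_conj]
      refine integral_congr_ae ?_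
      filter_upwards [h3] with x hx
      rw [hx]; simp [mul_comm]
    rw [h5, RCLike.norm_conj] at h4
    refine h4.trans (le_of_eq ?_)
    rw [Lp.norm_def, eLpNorm_congr_ae h3]
    congr 2
    exact eLpNorm_congr_norm_ae (by simp)
  have := key f
  rw [inner_self_eq_norm_sq_to_K] at this
  simp only [norm_pow, RCLike.norm_ofReal, abs_norm] at this
  rcases (norm_nonneg f).eq_or_lt with h0 | h0
  · rw [← h0]; exact hC
  · nlinarith

/-- By duality it suffices to pair the difference with a test function. The pairing is the increment
of a smooth convolution between two points at distance ‖h‖, so the mean value inequality bounds it.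
-/
theorem eLpNorm_shiftFun_sub_le {u : L2Space N} {g : Fin N → L2Space N}
    (hg : IsWeakGradient u g) (h : RN N) :
    eLpNorm (shiftFun h u - ⇑u) 2 volume ≤ ENNReal.ofReal (‖h‖ * ∑ j, ‖g j‖) := by
  have hm : MemLp (shiftFun h u - ⇑u) 2 volume := (memLp_shiftFun h u).sub (Lp.memLp u)
  have key : ‖hm.toLp _‖ ≤ ‖h‖ * ∑ j, ‖g j‖ := by
    refine norm_le_of_forall_test (by positivity) fun η hη hc => ?_
    -- The reflection turns the pairing of a translate of `u` with `η` into a value of the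
    -- convolution of `u` with `θ`.
    set θ : RN N → ℂ := fun x => η (-x) with hθ
    have hθ1 : ContDiff ℝ ∞ θ := hη.comp contDiff_neg
    have hθ2 : HasCompactSupport θ := hc.comp_homeomorph (Homeomorph.neg _)
    have e1 : ∫ x, hm.toLp _ x * η x = conv u θ (-h) - conv u θ 0 := by
      have i1 : Integrable (fun x => shiftFun h u x * η x) volume :=
        (memLp_shiftFun h u).integrable_mul (memLp_two_of_test hη.continuous hc)
      have i2 : Integrable (fun x => u x * η x) volume :=
        (Lp.memLp u).integrable_mul (memLp_two_of_test hη.continuous hc)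
      rw [conv_apply, conv_apply]
      have : ∫ t, u t * θ (-h - t) = ∫ x, shiftFun h u x * η x := by
        rw [← integral_sub_right_eq_self (fun t => u t * θ (-h - t)) h]
        refine integral_congr_ae (Eventually.of_forall fun x => ?_)
        simp [shiftFun, hθ]
      rw [this]
      simp only [hθ, zero_sub, neg_neg]
      rw [← integral_sub i1 i2]
      refine integral_congr_ae ?_
      filter_upwards [hm.coeFn_toLp] with x hx
      rw [hx]; simp [sub_mul]
    rw [e1]
    have e2 : eLpNorm θ 2 volume = eLpNorm η 2 volume :=
      eLpNorm_comp_measurePreserving (p := 2) hη.continuous.aestronglyMeasurable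
        (Measure.measurePreserving_neg volume)
    have := Convex.norm_image_sub_le_of_norm_fderiv_le (𝕜 := ℝ) (f := conv u θ) (s := Set.univ)
      (C := (∑ j, ‖g j‖) * (eLpNorm θ 2 volume).toReal) (x := 0) (y := -h)
      (fun x _ => ((conv_contDiff u hθ1 hθ2).differentiable (by simp)).differentiableAt)
      (fun x _ => norm_fderiv_conv_le hg hθ1 hθ2 x) convex_univ trivial trivial
    refine this.trans (le_of_eq ?_)
    rw [e2]; simp; ring
  rw [Lp.norm_toLp] at key
  exact (ENNReal.le_ofReal_iff_toReal_le hm.eLpNorm_ne_top (by positivity)).2 key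

/-- Jensen's inequality for the average of a family of functions. -/
theorem lintegral_enorm_integral_sq_le {X Y : Type*} [MeasurableSpace X] [MeasurableSpace Y]
    {μ : Measure X} {P : Measure Y} [SFinite μ] [IsProbabilityMeasure P] {F : X × Y → ℂ}
    (hF : StronglyMeasurable F) :
    ∫⁻ x, ‖∫ y, F (x, y) ∂P‖ₑ ^ 2 ∂μ ≤ ∫⁻ y, ∫⁻ x, ‖F (x, y)‖ₑ ^ 2 ∂μ ∂P := by
  rw [← lintegral_lintegral_swap (by
    exact (hF.measurable.enorm.pow_const 2).aemeasurable)]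
  refine lintegral_mono fun x => ?_
  have hx : AEStronglyMeasurable (fun y => F (x, y)) P :=
    (hF.comp_measurable measurable_prodMk_left).aestronglyMeasurable
  have h1 : ‖∫ y, F (x, y) ∂P‖ₑ ≤ eLpNorm (fun y => F (x, y)) 2 P := by
    refine (enorm_integral_le_lintegral_enorm _).trans ?_
    rw [← eLpNorm_one_eq_lintegral_enorm]
    exact eLpNorm_le_eLpNorm_of_exponent_le (by norm_num) hx
  calc ‖∫ y, F (x, y) ∂P‖ₑ ^ 2 ≤ (eLpNorm (fun y => F (x, y)) 2 P) ^ 2 := by gcongr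
    _ = _ := by
      rw [eLpNorm_eq_lintegral_rpow_enorm_toReal (by norm_num) (by norm_num)]
      rw [← ENNReal.rpow_natCast, ← ENNReal.rpow_mul]
      simp

/-- The smooth approximate identity, complex valued. -/
def mollifier (b : ContDiffBump (0 : RN N)) : RN N → ℂ := fun x => (b.normed volume x : ℂ)

theorem mollifier_contDiff (b : ContDiffBump (0 : RN N)) : ContDiff ℝ ∞ (mollifier b) :=
  Complex.ofRealCLM.contDiff.comp b.contDiff_normed

theorem mollifier_hasCompactSupport (b : ContDiffBump (0 : RN N)) :
    HasCompactSupport (mollifier b) :=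
  b.hasCompactSupport_normed.comp_left Complex.ofReal_zero

theorem mollifier_eq_zero (b : ContDiffBump (0 : RN N)) {x : RN N} (hx : b.rOut ≤ ‖x‖) :
    mollifier b x = 0 := by
  have : x ∉ Function.support (b.normed volume) := by
    rw [b.support_normed_eq]; simpa using hx
  simpa [mollifier] using this

/-- The probability measure whose density is the approximate identity. -/
def mollifierMeasure (b : ContDiffBump (0 : RN N)) : Measure (RN N) :=
  volume.withDensity fun x => ENNReal.ofReal (b.normed volume x)

instance (b : ContDiffBump (0 : RN N)) : IsProbabilityMeasure (mollifierMeasure b) := by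
  constructor
  rw [mollifierMeasure, withDensity_apply _ MeasurableSet.univ, Measure.restrict_univ,
    ← ofReal_integral_eq_lintegral_ofReal b.integrable_normed
      (Eventually.of_forall b.nonneg_normed), b.integral_normed, ENNReal.ofReal_one]

theorem integral_mollifierMeasure (b : ContDiffBump (0 : RN N)) (f : RN N → ℂ) :
    ∫ h, f h ∂(mollifierMeasure b) = ∫ h, mollifier b h * f h := by
  rw [mollifierMeasure, integral_withDensity_eq_integral_toReal_smul
    (by have := b.continuous_normed (μ := (volume : Measure (RN N))); fun_prop) (by simp)]
  refine integral_congr_ae (Eventually.of_forall fun x => ?_)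
  simp [mollifier, ENNReal.toReal_ofReal (b.nonneg_normed x)]

/-- The mollifier is a probability density, so the mollification error is an average of translation
errors. Jensen's inequality then bounds its L² norm by the modulus of continuity of translations. -/
theorem conv_mollifier_sub (b : ContDiffBump (0 : RN N)) (u : L2Space N) (x : RN N) :
    conv u (mollifier b) x - u x = ∫ h, (shiftFun h u x - u x) ∂(mollifierMeasure b) := by
  have hI : Integrable (fun h => mollifier b h * shiftFun h u x) volume := by
    have h1 : MemLp (fun h => u (x - h)) 2 volume :=
      (Lp.memLp u).comp_measurePreserving (Measure.measurePreserving_sub_left volume x)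
    exact (memLp_two_of_test (mollifier_contDiff b).continuous
      (mollifier_hasCompactSupport b)).integrable_mul h1
  have hI2 : Integrable (mollifier b) volume :=
    (mollifier_contDiff b).continuous.integrable_of_hasCompactSupport (mollifier_hasCompactSupport b)
  rw [integral_mollifierMeasure]
  simp only [mul_sub]
  rw [integral_sub hI (hI2.mul_const _), integral_mul_const]
  have h2 : ∫ h, mollifier b h = 1 := by
    simp only [mollifier]
    rw [integral_complex_ofReal, b.integral_normed, Complex.ofReal_one]
  rw [h2, one_mul, conv_apply, ← integral_sub_left_eq_self _ _ x]
  congr 1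
  refine integral_congr_ae (Eventually.of_forall fun t => ?_)
  simp [shiftFun, mul_comm]

theorem eLpNorm_two_sq {X : Type*} [MeasurableSpace X] {μ : Measure X} (f : X → ℂ) :
    eLpNorm f 2 μ ^ 2 = ∫⁻ x, ‖f x‖ₑ ^ 2 ∂μ := by
  rw [eLpNorm_eq_lintegral_rpow_enorm_toReal (by norm_num) (by norm_num),
    ← ENNReal.rpow_natCast, ← ENNReal.rpow_mul]
  simp

/-- The error of mollification is controlled by the modulus of continuity of translations. -/
theorem eLpNorm_conv_mollifier_sub_le (b : ContDiffBump (0 : RN N)) (u : L2Space N) {ε : ℝ≥0∞}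
    (hε : ∀ h : RN N, ‖h‖ < b.rOut → eLpNorm (shiftFun h u - ⇑u) 2 volume ≤ ε) :
    eLpNorm (conv u (mollifier b) - ⇑u) 2 volume ≤ ε := by
  have hsupp : ∀ᵐ h ∂(mollifierMeasure b), ‖h‖ < b.rOut := by
    rw [mollifierMeasure, ae_withDensity_iff
      (by have := b.continuous_normed (μ := (volume : Measure (RN N))); fun_prop)]
    refine Eventually.of_forall fun x hx => ?_
    by_contra hcon
    have : x ∉ Function.support (b.normed (volume : Measure (RN N))) := by
      rw [b.support_normed_eq]; simpa using hcon
    simp at this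
    simp [this] at hx
  have h1 : eLpNorm (conv u (mollifier b) - ⇑u) 2 volume ^ 2 ≤ ε ^ 2 := by
    rw [eLpNorm_two_sq]
    simp only [Pi.sub_apply, conv_mollifier_sub]
    have hu := Lp.stronglyMeasurable u
    refine (lintegral_enorm_integral_sq_le (μ := volume) (P := mollifierMeasure b)
      (F := fun p : RN N × RN N => shiftFun p.2 u p.1 - u p.1) ?_).trans ?_
    · exact (hu.comp_measurable (measurable_fst.sub measurable_snd)).sub
        (hu.comp_measurable measurable_fst)
    · calc _ ≤ ∫⁻ _, ε ^ 2 ∂(mollifierMeasure b) := by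
            refine lintegral_mono_ae ?_
            filter_upwards [hsupp] with h hh
            have := hε h hh
            have h2 := eLpNorm_two_sq (μ := volume) (shiftFun h u - ⇑u)
            simp only [Pi.sub_apply] at h2
            rw [← h2]
            gcongr
        _ = ε ^ 2 := by simp
  exact (ENNReal.pow_le_pow_left_iff (by norm_num)).1 h1

/-! ### From test functions to compactly supported `H¹` functions -/

theorem conv_mollifier_eq_zero (b : ContDiffBump (0 : RN N)) {w : L2Space N} {R : ℝ}
    (hw : ∀ᵐ z, R ≤ ‖z‖ → w z = 0) {x : RN N} (hx : R + b.rOut ≤ ‖x‖) :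
    conv w (mollifier b) x = 0 := by
  rw [conv_apply]
  refine integral_eq_zero_of_ae ?_
  filter_upwards [hw] with t ht
  rcases le_or_gt R ‖t‖ with h | h
  · simp [ht h]
  · rw [mollifier_eq_zero b (by linarith [norm_sub_norm_le x t]), mul_zero]; rfl

theorem hasCompactSupport_conv_mollifier (b : ContDiffBump (0 : RN N)) {w : L2Space N} {R : ℝ}
    (hw : ∀ᵐ z, R ≤ ‖z‖ → w z = 0) : HasCompactSupport (conv w (mollifier b)) :=
  HasCompactSupport.intro (isCompact_closedBall 0 (R + b.rOut)) fun x hx =>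
    conv_mollifier_eq_zero b hw (by simp at hx; exact hx.le)

theorem memLp_conv_mollifier (b : ContDiffBump (0 : RN N)) {w : L2Space N} {R : ℝ}
    (hw : ∀ᵐ z, R ≤ ‖z‖ → w z = 0) : MemLp (conv w (mollifier b)) 2 volume :=
  memLp_two_of_test (conv_contDiff w (mollifier_contDiff b)
    (mollifier_hasCompactSupport b)).continuous (hasCompactSupport_conv_mollifier b hw)

/-- Local square integrability. -/
def LocallyL2 (G : RN N → ℂ) : Prop :=
  ∀ r : ℝ, MemLp ((Metric.ball (0 : RN N) r).indicator G) 2 volume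

theorem LocallyL2.integral_mul {G f : RN N → ℂ} (hG : LocallyL2 G) (hf : MemLp f 2 volume) {r : ℝ}
    (h0 : ∀ᵐ z, r ≤ ‖z‖ → f z = 0) :
    Integrable (fun z => G z * f z) volume ∧
      ∫ z, G z * f z = ∫ z, (Metric.ball (0 : RN N) r).indicator G z * f z := by
  have : (fun z => (Metric.ball (0 : RN N) r).indicator G z * f z) =ᵐ[volume]
      fun z => G z * f z := by
    filter_upwards [h0] with z hz
    by_cases h : ‖z‖ < r
    · rw [Set.indicator_of_mem (by simpa using h)]
    · rw [hz (not_lt.1 h), mul_zero, mul_zero]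
  exact ⟨((hG r).integrable_fun_mul hf).congr this, (integral_congr_ae this).symm⟩

/-- All the functions involved vanish outside the ball of radius R + 1, so `G` may be truncated to
an L² function. The claim then follows from the L² convergence of mollifications. -/
theorem tendsto_integral_mul_conv {G : RN N → ℂ} (hG : LocallyL2 G) {w : L2Space N} {R : ℝ}
    (hw : ∀ᵐ z, R ≤ ‖z‖ → w z = 0) {b : ℕ → ContDiffBump (0 : RN N)}
    (hb : Tendsto (fun n => (b n).rOut) atTop (𝓝 0)) (hb1 : ∀ n, (b n).rOut ≤ 1) :
    Tendsto (fun n => ∫ z, G z * conv w (mollifier (b n)) z) atTop (𝓝 (∫ z, G z * w z)) := by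
  have hm : ∀ n, MemLp (conv w (mollifier (b n)) - ⇑w) 2 volume := fun n =>
    (memLp_conv_mollifier (b n) hw).sub (Lp.memLp w)
  have e1 : ∀ n, ∫ z, G z * conv w (mollifier (b n)) z
      = ∫ z, (Metric.ball (0 : RN N) (R + 1)).indicator G z * conv w (mollifier (b n)) z := fun n =>
    (hG.integral_mul (memLp_conv_mollifier (b n) hw) (Eventually.of_forall fun z hz =>
      conv_mollifier_eq_zero (b n) hw (by linarith [hb1 n]))).2
  have e2 : ∫ z, G z * w z = ∫ z, (Metric.ball (0 : RN N) (R + 1)).indicator G z * w z :=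
    (hG.integral_mul (Lp.memLp w) (hw.mono fun z hz h => hz (by linarith))).2
  rw [e2]
  simp only [e1]
  rw [tendsto_iff_norm_sub_tendsto_zero]
  have h0 : Tendsto (fun n => eLpNorm (conv w (mollifier (b n)) - ⇑w) 2 volume) atTop (𝓝 0) := by
    rw [ENNReal.tendsto_nhds_zero]
    intro ε hε
    obtain ⟨δ, hδ, hδ'⟩ := Metric.eventually_nhds_iff.1
      ((ENNReal.tendsto_nhds_zero.1 (tendsto_shiftFun_sub w)) ε hε)
    filter_upwards [hb.eventually_lt_const hδ] with n hn
    exact eLpNorm_conv_mollifier_sub_le (b n) w fun h hh => hδ' (by simpa using hh.trans hn)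
  have h1 : Tendsto (fun n => (eLpNorm ((Metric.ball (0 : RN N) (R + 1)).indicator G) 2 volume).toReal
      * (eLpNorm (conv w (mollifier (b n)) - ⇑w) 2 volume).toReal) atTop (𝓝 0) := by
    have := ((ENNReal.tendsto_toReal ENNReal.zero_ne_top).comp h0).const_mul
      (eLpNorm ((Metric.ball (0 : RN N) (R + 1)).indicator G) 2 volume).toReal
    simpa using this
  refine squeeze_zero (fun _ => norm_nonneg _) (fun n => ?_) h1
  rw [← integral_sub ((hG _).integrable_fun_mul (memLp_conv_mollifier (b n) hw))
    ((hG _).integrable_fun_mul (Lp.memLp w))]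
  refine le_trans (le_of_eq ?_) (norm_integral_mul_le (hG (R + 1)) (hm n))
  congr 1
  refine integral_congr_ae (Eventually.of_forall fun z => ?_)
  simp [mul_sub]

/-- A first order identity that holds against test functions holds against compactly supported
`H¹` functions. -/
theorem integral_pairing_eq_zero {G0 : RN N → ℂ} {G : Fin N → RN N → ℂ} (hG0 : LocallyL2 G0)
    (hG : ∀ j, LocallyL2 (G j))
    (h : ∀ η : RN N → ℂ, ContDiff ℝ ∞ η → HasCompactSupport η →
      ∫ z, ((∑ j, G j z * fderiv ℝ η z (stdVec j)) + G0 z * η z) = 0)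
    {u : L2Space N} {p : Fin N → L2Space N} (hp : IsWeakGradient u p) {R : ℝ}
    (hu0 : ∀ᵐ z, R ≤ ‖z‖ → u z = 0) (hp0 : ∀ j, ∀ᵐ z, R ≤ ‖z‖ → p j z = 0) :
    ∫ z, ((∑ j, G j z * p j z) + G0 z * u z) = 0 := by
  let b : ℕ → ContDiffBump (0 : RN N) := fun n =>
    ⟨1 / ((n : ℝ) + 2), 1 / ((n : ℝ) + 1), by positivity, by gcongr; norm_num⟩
  have hb : Tendsto (fun n => (b n).rOut) atTop (𝓝 0) := tendsto_one_div_add_atTop_nhds_zero_nat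
  have hb1 : ∀ n, (b n).rOut ≤ 1 := fun n => by
    show 1 / ((n : ℝ) + 1) ≤ 1
    rw [div_le_one (by positivity)]; linarith [n.cast_nonneg (α := ℝ)]
  have hlim : Tendsto (fun n => (∑ j, ∫ z, G j z * conv (p j) (mollifier (b n)) z)
      + ∫ z, G0 z * conv u (mollifier (b n)) z) atTop
      (𝓝 ((∑ j, ∫ z, G j z * p j z) + ∫ z, G0 z * u z)) :=
    (tendsto_finsetSum _ fun j _ => tendsto_integral_mul_conv (hG j) (hp0 j) hb hb1).add
      (tendsto_integral_mul_conv hG0 hu0 hb hb1)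
  have hz : ∀ n, (∑ j, ∫ z, G j z * conv (p j) (mollifier (b n)) z)
      + ∫ z, G0 z * conv u (mollifier (b n)) z = 0 := by
    intro n
    -- The mollification of `u` is an admissible test function, and its gradient is the
    -- mollification of `p`.
    have h1 := h (conv u (mollifier (b n))) (conv_contDiff u (mollifier_contDiff _)
      (mollifier_hasCompactSupport _)) (hasCompactSupport_conv_mollifier _ hu0)
    simp only [fderiv_conv_stdVec hp (mollifier_contDiff (b n))
      (mollifier_hasCompactSupport (b n))] at h1
    have i1 : ∀ j, Integrable (fun z => G j z * conv (p j) (mollifier (b n)) z) volume := fun j =>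
      ((hG j).integral_mul (memLp_conv_mollifier (b n) (hp0 j)) (r := R + 1)
        (Eventually.of_forall fun z hz =>
          conv_mollifier_eq_zero (b n) (hp0 j) (by linarith [hb1 n]))).1
    have i0 : Integrable (fun z => G0 z * conv u (mollifier (b n)) z) volume :=
      (hG0.integral_mul (memLp_conv_mollifier (b n) hu0) (r := R + 1)
        (Eventually.of_forall fun z hz =>
          conv_mollifier_eq_zero (b n) hu0 (by linarith [hb1 n]))).1
    rw [integral_add (integrable_finsetSum _ fun j _ => i1 j) i0,
      integral_finsetSum _ fun j _ => i1 j] at h1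
    exact h1
  simp only [hz] at hlim
  rw [integral_add (integrable_finsetSum _ fun j _ => ((hG j).integral_mul (Lp.memLp _) (hp0 j)).1)
    (hG0.integral_mul (Lp.memLp _) hu0).1,
    integral_finsetSum _ fun j _ => ((hG j).integral_mul (Lp.memLp _) (hp0 j)).1]
  exact (tendsto_nhds_unique hlim tendsto_const_nhds)

/-! ### Calculus of weak gradients -/

theorem fderiv_real_mul_stdVec {W : RN N → ℝ} (hW : ContDiff ℝ ∞ W) {η : RN N → ℂ}
    (hη : ContDiff ℝ ∞ η) (z v : RN N) :
    fderiv ℝ (fun z => (W z : ℂ) * η z) z v =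
      (fderiv ℝ W z v : ℂ) * η z + (W z : ℂ) * fderiv ℝ η z v := by
  have h1 : HasFDerivAt (fun z => (W z : ℂ)) (Complex.ofRealCLM.comp (fderiv ℝ W z)) z :=
    Complex.ofRealCLM.hasFDerivAt.comp z (hW.differentiable (by simp)).differentiableAt.hasFDerivAt
  have h2 := h1.mul (hη.differentiable (by simp)).differentiableAt.hasFDerivAt
  rw [show (fun z => (W z : ℂ) * η z) = (fun z => (W z : ℂ)) * η from rfl, h2.fderiv]
  simp [smul_eq_mul]
  ring

theorem fderiv_conj_apply {η : RN N → ℂ} (hη : ContDiff ℝ ∞ η) (z v : RN N) :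
    fderiv ℝ (fun z => conj (η z)) z v = conj (fderiv ℝ η z v) := by
  have h2 : HasFDerivAt (fun z => conj (η z))
      ((Complex.conjCLE : ℂ →L[ℝ] ℂ).comp (fderiv ℝ η z)) z :=
    (Complex.conjCLE : ℂ →L[ℝ] ℂ).hasFDerivAt.comp z
      (hη.differentiable (by simp)).differentiableAt.hasFDerivAt
  rw [h2.fderiv]; simp

theorem contDiff_fderiv_apply {F : Type*} [NormedAddCommGroup F] [NormedSpace ℝ F]
    {η : RN N → F} (hη : ContDiff ℝ ∞ η) (v : RN N) :
    ContDiff ℝ ∞ fun z => fderiv ℝ η z v :=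
  (hη.fderiv_right (m := ∞) (by simp)).clm_apply contDiff_const

theorem hasCompactSupport_fderiv_apply {F : Type*} [NormedAddCommGroup F] [NormedSpace ℝ F]
    {η : RN N → F} (hc : HasCompactSupport η) (v : RN N) :
    HasCompactSupport fun z => fderiv ℝ η z v :=
  (hc.fderiv ℝ).comp_left (g := fun L : RN N →L[ℝ] F => L v) rfl

theorem memLp_fderiv_apply {η : RN N → ℂ} (hη : ContDiff ℝ ∞ η) (hc : HasCompactSupport η)
    (v : RN N) : MemLp (fun z => fderiv ℝ η z v) 2 volume :=
  memLp_two_of_test (contDiff_fderiv_apply hη v).continuous (hasCompactSupport_fderiv_apply hc v)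

theorem IsWeakGradient.sub {u v : L2Space N} {g h : Fin N → L2Space N} (hg : IsWeakGradient u g)
    (hh : IsWeakGradient v h) : IsWeakGradient (u - v) (g - h) := by
  intro j η hη hc
  have m1 := memLp_two_of_test hη.continuous hc
  have m2 := memLp_fderiv_apply hη hc (stdVec j)
  have e1 : ∫ z, (g - h) j z * η z = (∫ z, g j z * η z) - ∫ z, h j z * η z := by
    rw [← integral_sub ((Lp.memLp _).integrable_fun_mul m1) ((Lp.memLp _).integrable_fun_mul m1)]
    refine integral_congr_ae ?_
    filter_upwards [Lp.coeFn_sub (g j) (h j)] with z hz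
    rw [Pi.sub_apply g h j, hz, Pi.sub_apply, sub_mul]
  have e2 : ∫ z, (u - v) z * fderiv ℝ η z (stdVec j) = (∫ z, u z * fderiv ℝ η z (stdVec j)) -
      ∫ z, v z * fderiv ℝ η z (stdVec j) := by
    rw [← integral_sub ((Lp.memLp _).integrable_fun_mul m2) ((Lp.memLp _).integrable_fun_mul m2)]
    refine integral_congr_ae ?_
    filter_upwards [Lp.coeFn_sub u v] with z hz
    rw [hz, Pi.sub_apply, sub_mul]
  rw [e1, e2, hg j η hη hc, hh j η hη hc]; ring

/-- The weak gradient of `V φ̄`, for `V` real, smooth and compactly supported. -/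
theorem isWeakGradient_real_mul_conj {φ : L2Space N} {g : Fin N → L2Space N}
    (hg : IsWeakGradient φ g) {V : RN N → ℝ} (hV : ContDiff ℝ ∞ V)
    {u : L2Space N} {p : Fin N → L2Space N} (hu : ∀ᵐ z, u z = (V z : ℂ) * conj (φ z))
    (hp : ∀ j, ∀ᵐ z, p j z =
      (V z : ℂ) * conj (g j z) + (fderiv ℝ V z (stdVec j) : ℂ) * conj (φ z)) :
    IsWeakGradient u p := by
  intro j η hη hc
  have c1 : ContDiff ℝ ∞ fun z => (V z : ℂ) := Complex.ofRealCLM.contDiff.comp hV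
  have t1 : ContDiff ℝ ∞ fun z => (V z : ℂ) * η z := c1.mul hη
  have t2 : HasCompactSupport fun z => (V z : ℂ) * η z := hc.mul_left
  have t3 : ContDiff ℝ ∞ fun z => conj ((V z : ℂ) * η z) := Complex.conjCLE.contDiff.comp t1
  have t4 : HasCompactSupport fun z => conj ((V z : ℂ) * η z) := t2.comp_left (map_zero _)
  -- Testing the gradient of φ with the conjugate of V η and conjugating the identity transfers it
  -- to φ̄.
  have h1 := congrArg conj (hg j _ t3 t4)
  rw [map_neg, ← integral_conj, ← integral_conj] at h1
  simp only [fderiv_conj_apply t1, fderiv_real_mul_stdVec hV hη] at h1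
  simp only [map_mul, Complex.conj_conj, Complex.conj_ofReal, map_add] at h1
  have m0 : MemLp (fun z => conj (φ z)) 2 volume := (Lp.memLp φ).star
  have m1 : MemLp (fun z => (fderiv ℝ V z (stdVec j) : ℂ) * η z) 2 volume :=
    memLp_two_of_test ((Complex.continuous_ofReal.comp
      (contDiff_fderiv_apply hV _).continuous).mul hη.continuous) hc.mul_left
  have m2 : MemLp (fun z => (V z : ℂ) * fderiv ℝ η z (stdVec j)) 2 volume :=
    memLp_two_of_test (c1.continuous.mul (contDiff_fderiv_apply hη _).continuous)
      (hasCompactSupport_fderiv_apply hc _).mul_left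
  have i1 := m0.integrable_fun_mul m1
  have i2 := m0.integrable_fun_mul m2
  have i3 : Integrable (fun z => conj (g j z) * ((V z : ℂ) * η z)) volume :=
    (Lp.memLp (g j)).star.integrable_fun_mul (memLp_two_of_test t1.continuous t2)
  have e1 : ∫ z, p j z * η z = (∫ z, conj (g j z) * ((V z : ℂ) * η z)) +
      ∫ z, conj (φ z) * ((fderiv ℝ V z (stdVec j) : ℂ) * η z) := by
    rw [← integral_add i3 i1]
    refine integral_congr_ae ?_
    filter_upwards [hp j] with z hz
    rw [hz]; ring
  have e2 : ∫ z, u z * fderiv ℝ η z (stdVec j) =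
      ∫ z, conj (φ z) * ((V z : ℂ) * fderiv ℝ η z (stdVec j)) := by
    refine integral_congr_ae ?_
    filter_upwards [hu] with z hz
    rw [hz]; ring
  have e3 : ∫ z, conj (φ z) * ((fderiv ℝ V z (stdVec j) : ℂ) * η z
      + (V z : ℂ) * fderiv ℝ η z (stdVec j)) =
      (∫ z, conj (φ z) * ((fderiv ℝ V z (stdVec j) : ℂ) * η z)) +
      ∫ z, conj (φ z) * ((V z : ℂ) * fderiv ℝ η z (stdVec j)) := by
    rw [← integral_add i1 i2]
    refine integral_congr_ae (Eventually.of_forall fun z => ?_)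
    ring
  rw [e1, e2, h1, e3]; ring

/-! ### Energy estimates -/

theorem LocallyL2.sub {f g : RN N → ℂ} (hf : LocallyL2 f) (hg : LocallyL2 g) :
    LocallyL2 (fun z => f z - g z) := fun r => by
  have := (hf r).sub (hg r)
  rwa [← Set.indicator_sub'] at this

theorem LocallyL2.sum {ι : Type*} [Fintype ι] {f : ι → RN N → ℂ} (hf : ∀ i, LocallyL2 (f i)) :
    LocallyL2 (fun z => ∑ i, f i z) := fun r => by
  have := memLp_finsetSum (Finset.univ : Finset ι) fun i _ => hf i r
  refine this.ae_eq (Eventually.of_forall fun z => ?_)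
  by_cases hz : z ∈ Metric.ball (0 : RN N) r
  · simp only [Set.indicator_of_mem hz]
  · simp only [Set.indicator_of_notMem hz, Finset.sum_const_zero]

theorem LocallyL2.continuous_mul {a f : RN N → ℂ} (ha : Continuous a) (hf : MemLp f 2 volume) :
    LocallyL2 (fun z => a z * f z) := fun r => by
  obtain ⟨C, hC⟩ := (isCompact_closedBall (0 : RN N) r).exists_bound_of_continuousOn
    ha.continuousOn
  have hm : AEStronglyMeasurable (fun z => a z * f z) volume := ha.aestronglyMeasurable.mul hf.1
  have hI : MemLp ((Metric.ball (0 : RN N) r).indicator f) 2 volume :=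
    hf.indicator measurableSet_ball
  refine hI.of_le_mul (c := C) (hm.indicator measurableSet_ball) (Eventually.of_forall fun z => ?_)
  by_cases hz : z ∈ Metric.ball (0 : RN N) r
  · simp only [Set.indicator_of_mem hz, norm_mul]
    exact mul_le_mul_of_nonneg_right (hC z (Metric.ball_subset_closedBall hz)) (norm_nonneg _)
  · simp only [Set.indicator_of_notMem hz, norm_zero, mul_zero, le_refl]

/-- The pointwise coercivity of the quadratic symbol in `(z φ, ∇φ)`. -/
def SymbolCoercive (A : Matrix (Fin N) (Fin N) ℝ) (B : Matrix (Fin N) (Fin N) ℂ)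
    (D : Matrix (Fin N) (Fin N) ℝ) (κ : ℝ) : Prop :=
  ∀ (φ : ℂ) (g : Fin N → ℂ) (z : RN N),
    κ * (‖z‖ ^ 2 * ‖φ‖ ^ 2 + ∑ j, ‖g j‖ ^ 2) ≤
      ((∑ j, ((∑ k, (A j k : ℂ) * g k) - φ * ∑ k, B j k * (z k : ℂ)) * conj (g j)) +
        (∑ j, ∑ k, (D j k : ℂ) * (z k : ℂ) * (z j : ℂ)) * φ * conj φ).re

theorem sum_sum_mul_le {A : Matrix (Fin N) (Fin N) ℝ} {d : Fin N → ℝ} {δ : ℝ}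
    (hd : ∀ j, |d j| ≤ δ) (g : Fin N → ℂ) :
    ‖∑ j, (d j : ℂ) * ∑ k, (A j k : ℂ) * g k‖ ≤
      (∑ j, ∑ k, |A j k|) * δ * √(∑ j, ‖g j‖ ^ 2) := by
  have hg : ∀ k, ‖g k‖ ≤ √(∑ j, ‖g j‖ ^ 2) := fun k =>
    Real.le_sqrt_of_sq_le (Finset.single_le_sum (f := fun j => ‖g j‖ ^ 2)
      (fun _ _ => by positivity) (Finset.mem_univ k))
  refine (norm_sum_le _ _).trans ?_
  rw [Finset.sum_mul, Finset.sum_mul]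
  refine Finset.sum_le_sum fun j _ => ?_
  have h1 : ‖∑ k, (A j k : ℂ) * g k‖ ≤ (∑ k, |A j k|) * √(∑ j, ‖g j‖ ^ 2) := by
    refine (norm_sum_le _ _).trans ?_
    rw [Finset.sum_mul]
    refine Finset.sum_le_sum fun k _ => ?_
    rw [norm_mul, Complex.norm_real, Real.norm_eq_abs]
    gcongr
    exact hg k
  rw [norm_mul, Complex.norm_real, Real.norm_eq_abs]
  calc |d j| * ‖∑ k, (A j k : ℂ) * g k‖ ≤ δ * ((∑ k, |A j k|) * √(∑ j, ‖g j‖ ^ 2)) := by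
        gcongr
        · exact (abs_nonneg _).trans (hd j)
        · exact hd j
    _ = _ := by ring

/-- The right side contains the integrand of the weak equation tested with w²φ̄, where `w` and `d`
stand for the weight and its gradient at one point and the gradient of the test function is w²ḡ + 2w
d φ̄. It splits into w² times the coercive symbol, an A cross term absorbed by half of the
coercivity, a B cross term without real part, and the zero-order term. -/
theorem energy_pointwise {A D : Matrix (Fin N) (Fin N) ℝ} {B : Matrix (Fin N) (Fin N) ℂ} {κ : ℝ}
    (hκ : 0 < κ) (hco : SymbolCoercive A B D κ) (hB : ∀ j k, (B j k).re = 0) (c σ φ : ℂ)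
    (g : Fin N → ℂ) (z : RN N) (w δ : ℝ) (d : Fin N → ℝ) (hd : ∀ j, |d j| ≤ δ) :
    κ / 2 * (w ^ 2 * (‖z‖ ^ 2 * ‖φ‖ ^ 2 + ∑ j, ‖g j‖ ^ 2)) ≤
      ((∑ j, ((∑ k, (A j k : ℂ) * g k) - φ * ∑ k, B j k * (z k : ℂ)) *
          (((w ^ 2 : ℝ) : ℂ) * conj (g j) + ((2 * w * d j : ℝ) : ℂ) * conj φ)) +
        ((c + ∑ j, ∑ k, (D j k : ℂ) * (z k : ℂ) * (z j : ℂ)) * φ - σ * φ) *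
          (((w ^ 2 : ℝ) : ℂ) * conj φ)).re +
      ((σ - c).re * w ^ 2 + 2 * (∑ j, ∑ k, |A j k|) ^ 2 / κ * δ ^ 2) * ‖φ‖ ^ 2 := by
  have h1 := hco φ g z
  set Q : ℂ := (∑ j, ((∑ k, (A j k : ℂ) * g k) - φ * ∑ k, B j k * (z k : ℂ)) * conj (g j)) +
        (∑ j, ∑ k, (D j k : ℂ) * (z k : ℂ) * (z j : ℂ)) * φ * conj φ with hQ
  set X : ℂ := ∑ j, (d j : ℂ) * ∑ k, (A j k : ℂ) * g k with hX
  set Y : ℂ := ∑ j, (d j : ℂ) * ∑ k, B j k * (z k : ℂ) with hY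
  set a := ∑ j, ∑ k, |A j k| with ha
  have hX' : ‖X‖ ≤ a * δ * √(∑ j, ‖g j‖ ^ 2) := sum_sum_mul_le hd g
  -- Since B is imaginary and `d`, `z` are real, the commutator of the weight with the B term drops
  -- out of the real part. Otherwise it would contribute a term of order |w| |d| |z| ‖φ‖².
  have hYre : Y.re = 0 := by
    simp [hY, Complex.mul_re, hB]
  have e : (∑ j, ((∑ k, (A j k : ℂ) * g k) - φ * ∑ k, B j k * (z k : ℂ)) *
          (((w ^ 2 : ℝ) : ℂ) * conj (g j) + ((2 * w * d j : ℝ) : ℂ) * conj φ)) +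
        ((c + ∑ j, ∑ k, (D j k : ℂ) * (z k : ℂ) * (z j : ℂ)) * φ - σ * φ) *
          (((w ^ 2 : ℝ) : ℂ) * conj φ)
      = ((w ^ 2 : ℝ) : ℂ) * Q + ((2 * w : ℝ) : ℂ) * (conj φ * X)
        - ((2 * w * ‖φ‖ ^ 2 : ℝ) : ℂ) * Y - ((w ^ 2 * ‖φ‖ ^ 2 : ℝ) : ℂ) * (σ - c) := by
    have hφ : ((‖φ‖ ^ 2 : ℝ) : ℂ) = φ * conj φ := by
      rw [Complex.mul_conj, Complex.normSq_eq_norm_sq]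
    have e1 : ∑ j, ((∑ k, (A j k : ℂ) * g k) - φ * ∑ k, B j k * (z k : ℂ)) *
          (((w ^ 2 : ℝ) : ℂ) * conj (g j) + ((2 * w * d j : ℝ) : ℂ) * conj φ)
        = ((w ^ 2 : ℝ) : ℂ) * (∑ j, ((∑ k, (A j k : ℂ) * g k) - φ * ∑ k, B j k * (z k : ℂ)) *
            conj (g j)) + ((2 * w : ℝ) : ℂ) * (conj φ * X)
          - ((2 * w : ℝ) : ℂ) * (φ * conj φ * Y) := by
      rw [hX, hY, Finset.mul_sum, Finset.mul_sum, Finset.mul_sum, Finset.mul_sum, Finset.mul_sum,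
        ← Finset.sum_add_distrib, ← Finset.sum_sub_distrib]
      refine Finset.sum_congr rfl fun j _ => ?_
      push_cast
      ring
    rw [e1, hQ]
    rw [show ((2 * w * ‖φ‖ ^ 2 : ℝ) : ℂ) = ((2 * w : ℝ) : ℂ) * ((‖φ‖ ^ 2 : ℝ) : ℂ) by push_cast; ring,
      show ((w ^ 2 * ‖φ‖ ^ 2 : ℝ) : ℂ) = ((w ^ 2 : ℝ) : ℂ) * ((‖φ‖ ^ 2 : ℝ) : ℂ) by push_cast; ring,
      hφ]
    ring
  rw [e]
  simp only [Complex.add_re, Complex.sub_re, Complex.re_ofReal_mul, hYre]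
  set γ := √(∑ j, ‖g j‖ ^ 2) with hγ
  have hγ2 : γ ^ 2 = ∑ j, ‖g j‖ ^ 2 := Real.sq_sqrt (Finset.sum_nonneg fun _ _ => by positivity)
  have h2 : |(conj φ * X).re| ≤ ‖φ‖ * (a * δ * γ) := by
    refine (Complex.abs_re_le_norm _).trans ?_
    rw [norm_mul, RCLike.norm_conj]
    gcongr
  have h3 : -(2 * |w| * (‖φ‖ * (a * δ * γ))) ≤ 2 * w * (conj φ * X).re := by
    have : |2 * w * (conj φ * X).re| ≤ 2 * |w| * (‖φ‖ * (a * δ * γ)) := by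
      rw [abs_mul, abs_mul, abs_two]
      gcongr
    linarith [neg_abs_le (2 * w * (conj φ * X).re)]
  -- Young's inequality: the weights in the square are chosen to spend exactly κ/2 of the coercivity
  -- on the gradient, which costs 2a²δ²/κ in front of ‖φ‖².
  have h4 : 2 * |w| * (‖φ‖ * (a * δ * γ)) ≤ κ / 2 * (w ^ 2 * γ ^ 2)
      + 2 * a ^ 2 / κ * δ ^ 2 * ‖φ‖ ^ 2 := by
    have h5 : 0 ≤ κ / 2 * (|w| * γ - 2 / κ * (a * δ * ‖φ‖)) ^ 2 := by positivity
    have h6 : κ / 2 * (|w| * γ - 2 / κ * (a * δ * ‖φ‖)) ^ 2 = κ / 2 * (|w| ^ 2 * γ ^ 2)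
      + 2 * a ^ 2 / κ * δ ^ 2 * ‖φ‖ ^ 2 - 2 * |w| * (‖φ‖ * (a * δ * γ)) := by
      field_simp; ring
    rw [sq_abs] at h6
    linarith
  have h7 : w ^ 2 * (κ * (‖z‖ ^ 2 * ‖φ‖ ^ 2 + γ ^ 2)) ≤ w ^ 2 * Q.re := by
    rw [hγ2]; gcongr
  have h8 : 0 ≤ κ / 2 * (w ^ 2 * (‖z‖ ^ 2 * ‖φ‖ ^ 2)) := by positivity
  rw [← hγ2]
  linarith

/-- The weighted energy inequality for eigenfunctions. -/
theorem energy_le {A D : Matrix (Fin N) (Fin N) ℝ} {B : Matrix (Fin N) (Fin N) ℂ} {κ : ℝ}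
    (hκ : 0 < κ) (hco : SymbolCoercive A B D κ) (hB : ∀ j k, (B j k).re = 0) {c σ : ℂ}
    {φ : L2Space N} {g : Fin N → L2Space N} (hg : IsWeakGradient φ g)
    (hT : ∀ η : RN N → ℂ, ContDiff ℝ ∞ η → HasCompactSupport η →
      ∫ z, ((∑ j, ∑ k, (A j k : ℂ) * g k z * fderiv ℝ η z (stdVec j))
          - (∑ j, ∑ k, φ z * (B j k * (z k : ℂ)) * fderiv ℝ η z (stdVec j))
          + c * φ z * η z
          + (∑ j, ∑ k, (D j k : ℂ) * (z k : ℂ) * (z j : ℂ)) * φ z * η z) =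
        ∫ z, (σ • φ) z * η z)
    {W : RN N → ℝ} (hW : ContDiff ℝ ∞ W) (hWc : HasCompactSupport W) :
    Integrable (fun z => W z ^ 2 * (‖z‖ ^ 2 * ‖φ z‖ ^ 2 + ∑ j, ‖g j z‖ ^ 2)) volume ∧
    Integrable (fun z => ((σ - c).re * W z ^ 2
      + 2 * (∑ j, ∑ k, |A j k|) ^ 2 / κ * ‖fderiv ℝ W z‖ ^ 2) * ‖φ z‖ ^ 2) volume ∧
    κ / 2 * ∫ z, W z ^ 2 * (‖z‖ ^ 2 * ‖φ z‖ ^ 2 + ∑ j, ‖g j z‖ ^ 2) ≤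
      ∫ z, ((σ - c).re * W z ^ 2 + 2 * (∑ j, ∑ k, |A j k|) ^ 2 / κ * ‖fderiv ℝ W z‖ ^ 2)
        * ‖φ z‖ ^ 2 := by
  set G : Fin N → RN N → ℂ := fun j z =>
    (∑ k, (A j k : ℂ) * g k z) - φ z * ∑ k, B j k * (z k : ℂ) with hGdef
  set G0 : RN N → ℂ := fun z =>
    (c + ∑ j, ∑ k, (D j k : ℂ) * (z k : ℂ) * (z j : ℂ)) * φ z - σ * φ z with hG0def
  have hG : ∀ j, LocallyL2 (G j) := by
    intro j
    refine LocallyL2.sub (LocallyL2.sum fun k =>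
      LocallyL2.continuous_mul continuous_const (Lp.memLp (g k))) ?_
    have := LocallyL2.continuous_mul (a := fun z => ∑ k, B j k * (z k : ℂ)) (by fun_prop)
      (Lp.memLp φ)
    simpa only [mul_comm] using this
  have hG0 : LocallyL2 G0 :=
    LocallyL2.sub (LocallyL2.continuous_mul (by fun_prop) (Lp.memLp φ))
      (LocallyL2.continuous_mul continuous_const (Lp.memLp φ))
  have hid : ∀ η : RN N → ℂ, ContDiff ℝ ∞ η → HasCompactSupport η →
      ∫ z, ((∑ j, G j z * fderiv ℝ η z (stdVec j)) + G0 z * η z) = 0 := by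
    intro η hη hc
    have m1 := memLp_two_of_test hη.continuous hc
    obtain ⟨r, hr⟩ : ∃ r : ℝ, ∀ z, r ≤ ‖z‖ → η z = 0 ∧ ∀ v, fderiv ℝ η z v = 0 := by
      obtain ⟨r, hr⟩ := hc.isCompact.isBounded.subset_ball (0 : RN N)
      refine ⟨r, fun z hz => ?_⟩
      have hz' : z ∉ tsupport η := fun h => by
        have := hr h; simp at this; linarith
      refine ⟨image_eq_zero_of_notMem_tsupport hz', fun v => ?_⟩
      have : fderiv ℝ η z = 0 := image_eq_zero_of_notMem_tsupport fun h =>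
        hz' (tsupport_fderiv_subset ℝ h)
      simp [this]
    have i1 : ∀ j, Integrable (fun z => G j z * fderiv ℝ η z (stdVec j)) volume := fun j =>
      ((hG j).integral_mul (memLp_fderiv_apply hη hc _)
        (Eventually.of_forall fun z hz => (hr z hz).2 _)).1
    have i2 : Integrable (fun z => G0 z * η z) volume :=
      (hG0.integral_mul m1 (Eventually.of_forall fun z hz => (hr z hz).1)).1
    have i3 : Integrable (fun z => (σ • φ) z * η z) volume :=
      (Lp.memLp (σ • φ)).integrable_fun_mul m1
    have h1 := hT η hη hc
    have h2 : ∫ z, ((∑ j, ∑ k, (A j k : ℂ) * g k z * fderiv ℝ η z (stdVec j))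
          - (∑ j, ∑ k, φ z * (B j k * (z k : ℂ)) * fderiv ℝ η z (stdVec j))
          + c * φ z * η z
          + (∑ j, ∑ k, (D j k : ℂ) * (z k : ℂ) * (z j : ℂ)) * φ z * η z)
        = ∫ z, (((∑ j, G j z * fderiv ℝ η z (stdVec j)) + G0 z * η z) + (σ • φ) z * η z) := by
      refine integral_congr_ae ?_
      filter_upwards [Lp.coeFn_smul σ φ] with z hz
      rw [hz]
      simp only [hGdef, hG0def, sub_mul, Finset.sum_sub_distrib, Finset.sum_mul, Finset.mul_sum,
        Pi.smul_apply, smul_eq_mul, add_mul]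
      ring
    have i4 : Integrable (fun z => (∑ j, G j z * fderiv ℝ η z (stdVec j)) + G0 z * η z) volume :=
      (integrable_finsetSum _ fun j _ => i1 j).add i2
    rw [h2, integral_add i4 i3] at h1
    linear_combination h1
  have hV : ContDiff ℝ ∞ fun z => W z ^ 2 := hW.pow 2
  have hfV : ∀ z v, fderiv ℝ (fun z => W z ^ 2) z v = 2 * W z * fderiv ℝ W z v := by
    intro z v
    have := ((hW.differentiable (by simp)).differentiableAt (x := z)).hasFDerivAt.pow 2
    rw [this.fderiv]
    simp
  obtain ⟨R, hR⟩ : ∃ r : ℝ, ∀ z, r ≤ ‖z‖ → W z = 0 := by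
    obtain ⟨r, hr⟩ := hWc.isCompact.isBounded.subset_ball (0 : RN N)
    refine ⟨r, fun z hz => ?_⟩
    have hz' : z ∉ tsupport W := fun h => by
      have := hr h; simp at this; linarith
    exact image_eq_zero_of_notMem_tsupport hz'
  have hcb : ∀ (a : RN N → ℝ), Continuous a → HasCompactSupport a → ∀ f : RN N → ℂ,
      MemLp f 2 volume → MemLp (fun z => (a z : ℂ) * conj (f z)) 2 volume := by
    intro a ha hac f hf
    obtain ⟨C, hC⟩ := ha.bounded_above_of_compact_support hac
    refine MemLp.of_le_mul (c := C) hf.star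
      ((Complex.continuous_ofReal.comp ha).aestronglyMeasurable.mul hf.star.1)
      (Eventually.of_forall fun z => ?_)
    rw [norm_mul, Complex.norm_real, RCLike.norm_conj, Pi.star_apply, norm_star]
    exact mul_le_mul_of_nonneg_right (hC z) (norm_nonneg (f z))
  have hWcont := hW.continuous
  have hdW : ∀ j, Continuous fun z => fderiv ℝ W z (stdVec j) := fun j =>
    (contDiff_fderiv_apply hW _).continuous
  have hVc : HasCompactSupport fun z => W z ^ 2 := hWc.comp_left (g := fun t => t ^ 2) (by simp)
  have mu := hcb (fun z => W z ^ 2) (by fun_prop) hVc φ (Lp.memLp φ)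
  have mp1 := fun j => hcb (fun z => W z ^ 2) (by fun_prop) hVc (g j) (Lp.memLp (g j))
  have mp2 := fun j => hcb (fun z => 2 * W z * fderiv ℝ W z (stdVec j))
    (by have := hdW j; fun_prop) (hWc.mul_left.mul_right) φ (Lp.memLp φ)
  set u : L2Space N := mu.toLp _
  set p : Fin N → L2Space N := fun j => ((mp1 j).add (mp2 j)).toLp _
  have hu : ∀ᵐ z, u z = ((W z ^ 2 : ℝ) : ℂ) * conj (φ z) := mu.coeFn_toLp
  have hp : ∀ j, ∀ᵐ z, p j z = ((W z ^ 2 : ℝ) : ℂ) * conj (g j z)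
      + ((2 * W z * fderiv ℝ W z (stdVec j) : ℝ) : ℂ) * conj (φ z) :=
    fun j => ((mp1 j).add (mp2 j)).coeFn_toLp
  -- W²φ̄ is only H¹ with compact support, not smooth; the extended identity
  -- `integral_pairing_eq_zero` admits it as a test function.
  have hwg : IsWeakGradient u p := isWeakGradient_real_mul_conj hg hV hu fun j => by
    filter_upwards [hp j] with z hz
    rw [hz, hfV]
  have hu0 : ∀ᵐ z, R ≤ ‖z‖ → u z = 0 := by
    filter_upwards [hu] with z hz h
    rw [hz, hR z h]; simp
  have hp0 : ∀ j, ∀ᵐ z, R ≤ ‖z‖ → p j z = 0 := fun j => by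
    filter_upwards [hp j] with z hz h
    rw [hz, hR z h]; simp
  have hzero := integral_pairing_eq_zero hG0 hG hid hwg hu0 hp0
  have hint : Integrable (fun z => (∑ j, G j z * p j z) + G0 z * u z) volume :=
    (integrable_finsetSum _ fun j _ => ((hG j).integral_mul (Lp.memLp _) (hp0 j)).1).add
      (hG0.integral_mul (Lp.memLp _) hu0).1
  have hre : ∫ z, ((∑ j, G j z * p j z) + G0 z * u z).re = 0 := by
    have := integral_re (𝕜 := ℂ) hint
    simp only [RCLike.re_to_complex] at this
    rw [this, hzero]; rfl
  have hnf : Continuous fun z => ‖fderiv ℝ W z‖ := (hW.continuous_fderiv (by simp)).norm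
  have hi2 : Integrable (fun z => ((σ - c).re * W z ^ 2
      + 2 * (∑ j, ∑ k, |A j k|) ^ 2 / κ * ‖fderiv ℝ W z‖ ^ 2) * ‖φ z‖ ^ 2) volume := by
    have hcs : HasCompactSupport fun z => (σ - c).re * W z ^ 2
      + 2 * (∑ j, ∑ k, |A j k|) ^ 2 / κ * ‖fderiv ℝ W z‖ ^ 2 :=
      (hVc.mul_left).add (((hWc.fderiv ℝ).norm.comp_left (g := fun t => t ^ 2) (by simp)).mul_left)
    obtain ⟨C, hC⟩ := Continuous.bounded_above_of_compact_support (by fun_prop) hcs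
    exact (Lp.memLp φ).norm.integrable_sq.bdd_mul (c := C)
      (Continuous.aestronglyMeasurable (by fun_prop)) (Eventually.of_forall hC)
  have hpt : ∀ᵐ z, κ / 2 * (W z ^ 2 * (‖z‖ ^ 2 * ‖φ z‖ ^ 2 + ∑ j, ‖g j z‖ ^ 2)) ≤
      ((∑ j, G j z * p j z) + G0 z * u z).re + ((σ - c).re * W z ^ 2
      + 2 * (∑ j, ∑ k, |A j k|) ^ 2 / κ * ‖fderiv ℝ W z‖ ^ 2) * ‖φ z‖ ^ 2 := by
    filter_upwards [hu, ae_all_iff.2 hp] with z h1 h2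
    rw [h1]
    simp only [h2]
    refine energy_pointwise hκ hco hB c σ (φ z) (fun j => g j z) z (W z) ‖fderiv ℝ W z‖
      (fun j => fderiv ℝ W z (stdVec j)) (fun j => ?_)
    have := (fderiv ℝ W z).le_opNorm (stdVec j)
    simpa [stdVec] using this
  have hrhs := hint.re.add hi2
  -- Integrability of the weighted energy is itself a consequence: the integrand is nonnegative,
  -- measurable, and dominated pointwise by the integrable right side.
  have hLHS : Integrable (fun z => κ / 2 * (W z ^ 2 * (‖z‖ ^ 2 * ‖φ z‖ ^ 2 + ∑ j, ‖g j z‖ ^ 2)))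
      volume := by
    refine hrhs.mono' ?_ ?_
    · have h1 := (Lp.stronglyMeasurable φ).measurable
      have h2 := fun j => (Lp.stronglyMeasurable (g j)).measurable
      have h3 := hWcont.measurable
      exact Measurable.aestronglyMeasurable (by fun_prop)
    · filter_upwards [hpt] with z hz
      rw [Real.norm_of_nonneg (by positivity)]
      exact hz
  refine ⟨?_, hi2, ?_⟩
  · have := hLHS.const_mul (2 / κ)
    refine this.congr (Eventually.of_forall fun z => ?_)
    field_simp
  · rw [← integral_const_mul]
    have := integral_mono_ae hLHS hrhs hpt
    refine this.trans (le_of_eq ?_)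
    rw [Pi.add_def, integral_add hint.re hi2]
    simp only [RCLike.re_to_complex]
    rw [hre, zero_add]

/-! ### Uniqueness and decay -/

/-- Dilating one fixed bump by R gives the gradient bound C/R with `C` independent of R. -/
theorem exists_cutoff (N : ℕ) : ∃ C : ℝ, 0 ≤ C ∧ ∀ R : ℝ, 0 < R → ∃ χ : RN N → ℝ,
    ContDiff ℝ ∞ χ ∧ HasCompactSupport χ ∧ (∀ z, 0 ≤ χ z) ∧ (∀ z, χ z ≤ 1) ∧
    (∀ z, ‖z‖ ≤ R → χ z = 1) ∧ ∀ z, ‖fderiv ℝ χ z‖ ≤ C / R := by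
  let b : ContDiffBump (0 : RN N) := ⟨1, 2, one_pos, one_lt_two⟩
  have hb : ContDiff ℝ ∞ b := b.contDiff
  obtain ⟨C, hC⟩ := (hb.continuous_fderiv (by simp)).bounded_above_of_compact_support
    (b.hasCompactSupport.fderiv ℝ)
  refine ⟨C, (norm_nonneg _).trans (hC 0), fun R hR => ?_⟩
  refine ⟨fun z => b (R⁻¹ • z), hb.comp (contDiff_id.const_smul R⁻¹),
    b.hasCompactSupport.comp_smul (inv_ne_zero hR.ne'), fun z => b.nonneg, fun z => b.le_one,
    fun z hz => b.one_of_mem_closedBall ?_, fun z => ?_⟩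
  · simp only [mem_closedBall_zero_iff, norm_smul, norm_inv, Real.norm_eq_abs, abs_of_pos hR]
    show R⁻¹ * ‖z‖ ≤ 1
    rw [inv_mul_le_iff₀ hR]; simpa using hz
  · have h : HasFDerivAt (fun z => b (R⁻¹ • z))
        ((fderiv ℝ b (R⁻¹ • z)).comp (R⁻¹ • ContinuousLinearMap.id ℝ (RN N))) z :=
      (hb.differentiable (by simp)).differentiableAt.hasFDerivAt.comp z
        ((hasFDerivAt_id z).const_smul R⁻¹)
    rw [h.fderiv, ContinuousLinearMap.comp_smul, ContinuousLinearMap.comp_id, norm_smul, norm_inv,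
      Real.norm_eq_abs, abs_of_pos hR, div_eq_inv_mul]
    gcongr
    exact hC _

theorem ae_eq_zero_of_ball_integral {f : RN N → ℂ} (hf : MemLp f 2 volume)
    (h : ∀ r : ℝ, ∫ z in Metric.closedBall (0 : RN N) r, ‖f z‖ ^ 2 ≤ 0) : f =ᵐ[volume] 0 := by
  have hi : Integrable (fun z => ‖f z‖ ^ 2) volume := hf.norm.integrable_sq
  have h1 := (aecover_closedBall (μ := (volume : Measure (RN N))) (x := 0)
    (tendsto_natCast_atTop_atTop (R := ℝ))).integral_tendsto_of_countably_generated hi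
  have h2 : ∫ z, ‖f z‖ ^ 2 ≤ 0 := le_of_tendsto h1 (Eventually.of_forall fun n => h n)
  have h3 := (integral_eq_zero_iff_of_nonneg (fun z => by positivity) hi).1
    (le_antisymm h2 (integral_nonneg fun z => by positivity))
  filter_upwards [h3] with z hz
  simpa using hz

/-- An eigenfunction whose eigenvalue lies below the energy vanishes. -/
theorem eq_zero_of_re_lt {A D : Matrix (Fin N) (Fin N) ℝ} {B : Matrix (Fin N) (Fin N) ℂ} {κ : ℝ}
    (hκ : 0 < κ) (hco : SymbolCoercive A B D κ) (hB : ∀ j k, (B j k).re = 0) {c σ : ℂ}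
    {φ : L2Space N} (hT : HomogenizedOp A B c D φ (σ • φ)) (hσ : (σ - c).re < 0) : φ = 0 := by
  obtain ⟨g, hg, hT⟩ := hT
  rw [Lp.eq_zero_iff_ae_eq_zero]
  refine ae_eq_zero_of_ball_integral (Lp.memLp φ) fun r => ?_
  set s := (σ - c).re
  set C := 2 * (∑ j, ∑ k, |A j k|) ^ 2 / κ with hCdef
  have hC0 : 0 ≤ C := by positivity
  obtain ⟨C₁, hC₁, hcut⟩ := exists_cutoff N
  have hφ : Integrable (fun z => ‖φ z‖ ^ 2) volume := (Lp.memLp φ).norm.integrable_sq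
  -- The cutoff error is of order R⁻² times ‖φ‖², with no growing factor |z|, so only φ ∈ L² is
  -- needed to let R tend to infinity.
  have key : ∀ R : ℝ, 0 < R → r ≤ R → -s * ∫ z in Metric.closedBall (0 : RN N) r, ‖φ z‖ ^ 2 ≤
      C * (C₁ / R) ^ 2 * ∫ z, ‖φ z‖ ^ 2 := by
    intro R hR hrR
    obtain ⟨χ, h1, h2, h3, h4, h5, h6⟩ := hcut R hR
    obtain ⟨-, hi, he⟩ := energy_le hκ hco hB hg hT h1 h2
    have h7 : 0 ≤ κ / 2 * ∫ z, χ z ^ 2 * (‖z‖ ^ 2 * ‖φ z‖ ^ 2 + ∑ j, ‖g j z‖ ^ 2) :=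
      mul_nonneg (by positivity) (integral_nonneg fun z => by positivity)
    have h8 : ∫ z, (s * χ z ^ 2 + C * ‖fderiv ℝ χ z‖ ^ 2) * ‖φ z‖ ^ 2 ≤
        ∫ z, (s * (Metric.closedBall (0 : RN N) r).indicator (fun z => ‖φ z‖ ^ 2) z
          + C * (C₁ / R) ^ 2 * ‖φ z‖ ^ 2) := by
      refine integral_mono hi (((hφ.indicator measurableSet_closedBall).const_mul _).add
        (hφ.const_mul _)) fun z => ?_
      have e1 : C * ‖fderiv ℝ χ z‖ ^ 2 * ‖φ z‖ ^ 2 ≤ C * (C₁ / R) ^ 2 * ‖φ z‖ ^ 2 := by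
        gcongr; exact h6 z
      have e2 : s * χ z ^ 2 * ‖φ z‖ ^ 2 ≤
          s * (Metric.closedBall (0 : RN N) r).indicator (fun z => ‖φ z‖ ^ 2) z := by
        by_cases hz : z ∈ Metric.closedBall (0 : RN N) r
        · rw [Set.indicator_of_mem hz, h5 z (by simp at hz; linarith)]; simp
        · rw [Set.indicator_of_notMem hz, mul_zero, mul_assoc]
          exact mul_nonpos_of_nonpos_of_nonneg hσ.le (by positivity)
      simp only
      linarith
    have h9 := (h7.trans he).trans h8
    rw [integral_add ((hφ.indicator measurableSet_closedBall).const_mul _) (hφ.const_mul _),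
      integral_const_mul, integral_const_mul, integral_indicator measurableSet_closedBall] at h9
    linarith
  have hlim : Tendsto (fun R : ℝ => C * (C₁ / R) ^ 2 * ∫ z, ‖φ z‖ ^ 2) atTop (𝓝 0) := by
    have := (((tendsto_const_nhds (x := C₁)).div_atTop tendsto_id).pow 2).const_mul C |>.mul_const
      (∫ z, ‖φ z‖ ^ 2)
    simpa using this
  have hle : -s * ∫ z in Metric.closedBall (0 : RN N) r, ‖φ z‖ ^ 2 ≤ 0 :=
    ge_of_tendsto hlim (by
      filter_upwards [eventually_gt_atTop 0, eventually_ge_atTop r] with R h1 h2 using key R h1 h2)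
  exact nonpos_of_mul_nonpos_right hle (by linarith)

/-- Smooth compactly supported weights that approach a Gaussian of rate `δ`. -/
theorem exists_weight {δ : ℝ} (hδ : 0 < δ) {m : ℝ} (hm : 0 < m) : ∃ W : RN N → ℝ,
    ContDiff ℝ ∞ W ∧ HasCompactSupport W ∧
    (∀ z, W z ^ 2 ≤ Real.exp (δ * ‖z‖ ^ 2)) ∧
    (∀ z, ‖z‖ ≤ m → Real.exp (δ / 2 * ‖z‖ ^ 2) ≤ W z ^ 2) ∧
    (∀ z, ‖fderiv ℝ W z‖ ^ 2 ≤ 2 * δ ^ 2 * ‖z‖ ^ 2 * W z ^ 2 + 2) := by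
  obtain ⟨C, hC, hcut⟩ := exists_cutoff N
  set E := Real.exp (δ / 2 * m ^ 2) with hE
  have hE0 : 0 < E := Real.exp_pos _
  have hRpos : 0 < C * E + m := by positivity
  -- The cutoff radius is so large that the gradient of χ stays at most 1 after multiplication by
  -- e^q, which never exceeds E.
  obtain ⟨χ, h1, h2, h3, h4, h5, h6⟩ := hcut (C * E + m) hRpos
  -- The exponent is bounded for fixed m, behaves like δ|z|²/2 for |z| much smaller than m, and
  -- satisfies |∇q| ≤ δ|z| uniformly in m. For |z| ≤ m the denominator is at most 2, whence the
  -- halved rate in the lower bound on W².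
  set q : RN N → ℝ := fun z => δ / 2 * (‖z‖ ^ 2 / (1 + ‖z‖ ^ 2 / m ^ 2)) with hq
  have hpos : ∀ z : RN N, 0 < 1 + ‖z‖ ^ 2 / m ^ 2 := fun z => by positivity
  have hqc : ContDiff ℝ ∞ q := by
    refine contDiff_const.mul ((contDiff_norm_sq ℝ).div ?_ fun z => (hpos z).ne')
    exact contDiff_const.add ((contDiff_norm_sq ℝ).div_const _)
  have hq0 : ∀ z, 0 ≤ q z := fun z => by positivity
  have hq1 : ∀ z, q z ≤ δ / 2 * ‖z‖ ^ 2 := fun z => by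
    simp only [hq]
    gcongr
    exact div_le_self (by positivity) (by linarith [show 0 ≤ ‖z‖ ^ 2 / m ^ 2 by positivity])
  have hq2 : ∀ z, q z ≤ δ / 2 * m ^ 2 := fun z => by
    simp only [hq]
    gcongr
    rw [div_le_iff₀ (hpos z)]
    have : m ^ 2 * (1 + ‖z‖ ^ 2 / m ^ 2) = m ^ 2 + ‖z‖ ^ 2 := by field_simp
    rw [this]; linarith [sq_nonneg m]
  have hq3 : ∀ z, ‖z‖ ≤ m → δ / 4 * ‖z‖ ^ 2 ≤ q z := fun z hz => by
    have e1 : ‖z‖ ^ 2 / m ^ 2 ≤ 1 := by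
      rw [div_le_one (by positivity)]; gcongr
    have e2 : ‖z‖ ^ 2 / 2 ≤ ‖z‖ ^ 2 / (1 + ‖z‖ ^ 2 / m ^ 2) := by
      gcongr; linarith
    simp only [hq]
    nlinarith
  have hq4 : ∀ z, ‖fderiv ℝ q z‖ ≤ δ * ‖z‖ := fun z => by
    have d1 : HasDerivAt (fun r : ℝ => δ / 2 * (r / (1 + r / m ^ 2)))
        (δ / 2 * (1 / (1 + ‖z‖ ^ 2 / m ^ 2) ^ 2)) (‖z‖ ^ 2) := by
      have h := ((hasDerivAt_id (‖z‖ ^ 2)).div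
        (((hasDerivAt_id (‖z‖ ^ 2)).div_const (m ^ 2)).const_add 1) (hpos z).ne').const_mul (δ / 2)
      refine h.congr_deriv ?_
      show δ / 2 * ((1 * (1 + ‖z‖ ^ 2 / m ^ 2) - ‖z‖ ^ 2 * (1 / m ^ 2)) /
        (1 + ‖z‖ ^ 2 / m ^ 2) ^ 2) = _
      congr 2
      ring
    have d2 : HasFDerivAt (fun z : RN N => ‖z‖ ^ 2) (2 • (innerSL ℝ z)) z :=
      (hasStrictFDerivAt_norm_sq z).hasFDerivAt
    have d3 : HasFDerivAt q ((δ / 2 * (1 / (1 + ‖z‖ ^ 2 / m ^ 2) ^ 2)) • (2 • (innerSL ℝ z))) z :=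
      HasDerivAt.comp_hasFDerivAt (f := fun z : RN N => ‖z‖ ^ 2)
        (h₂ := fun r : ℝ => δ / 2 * (r / (1 + r / m ^ 2))) z d1 d2
    rw [d3.fderiv, norm_smul, two_smul, Real.norm_of_nonneg (by positivity)]
    have e1 : 1 / (1 + ‖z‖ ^ 2 / m ^ 2) ^ 2 ≤ 1 := by
      rw [div_le_one (by have := hpos z; positivity)]
      exact one_le_pow₀ (by linarith [show 0 ≤ ‖z‖ ^ 2 / m ^ 2 by positivity])
    have e2 : ‖innerSL ℝ z + innerSL ℝ z‖ ≤ 2 * ‖z‖ := by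
      refine (norm_add_le _ _).trans (le_of_eq ?_)
      rw [innerSL_apply_norm]; ring
    calc δ / 2 * (1 / (1 + ‖z‖ ^ 2 / m ^ 2) ^ 2) * ‖innerSL ℝ z + innerSL ℝ z‖
        ≤ δ / 2 * 1 * (2 * ‖z‖) := by gcongr
      _ = δ * ‖z‖ := by ring
  refine ⟨fun z => χ z * Real.exp (q z), h1.mul hqc.exp, h2.mul_right, fun z => ?_, fun z hz => ?_,
    fun z => ?_⟩
  · have e1 : χ z * Real.exp (q z) ≤ Real.exp (δ / 2 * ‖z‖ ^ 2) := by
      calc χ z * Real.exp (q z) ≤ 1 * Real.exp (δ / 2 * ‖z‖ ^ 2) := by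
            gcongr
            · exact h4 z
            · exact hq1 z
        _ = _ := one_mul _
    calc (χ z * Real.exp (q z)) ^ 2 ≤ (Real.exp (δ / 2 * ‖z‖ ^ 2)) ^ 2 := by
          have := h3 z; gcongr
      _ = _ := by rw [← Real.exp_nat_mul]; congr 1; push_cast; ring
  · show Real.exp (δ / 2 * ‖z‖ ^ 2) ≤ (χ z * Real.exp (q z)) ^ 2
    rw [h5 z (by nlinarith [mul_nonneg hC hE0.le]), one_mul, ← Real.exp_nat_mul]
    have := hq3 z hz
    exact Real.exp_le_exp.2 (by push_cast; linarith)
  · have d1 : HasFDerivAt (fun z => χ z * Real.exp (q z))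
        (χ z • (Real.exp (q z) • fderiv ℝ q z) + Real.exp (q z) • fderiv ℝ χ z) z :=
      (h1.differentiable (by simp)).differentiableAt.hasFDerivAt.mul
        (hqc.differentiable (by simp)).differentiableAt.hasFDerivAt.exp
    rw [d1.fderiv]
    set W := χ z * Real.exp (q z) with hW
    have hW0 : 0 ≤ W := mul_nonneg (h3 z) (Real.exp_pos _).le
    have e1 : ‖χ z • (Real.exp (q z) • fderiv ℝ q z)‖ ≤ W * (δ * ‖z‖) := by
      rw [smul_smul, norm_smul, Real.norm_of_nonneg hW0]
      gcongr
      exact hq4 z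
    have e2 : ‖Real.exp (q z) • fderiv ℝ χ z‖ ≤ 1 := by
      rw [norm_smul, Real.norm_of_nonneg (Real.exp_pos _).le]
      calc Real.exp (q z) * ‖fderiv ℝ χ z‖ ≤ E * (C / (C * E + m)) := by
            gcongr
            · exact Real.exp_le_exp.2 (hq2 z)
            · exact h6 z
        _ ≤ 1 := by
          rw [← mul_div_assoc, div_le_one hRpos]
          linarith
    have e3 : ‖χ z • (Real.exp (q z) • fderiv ℝ q z) + Real.exp (q z) • fderiv ℝ χ z‖ ≤
        W * (δ * ‖z‖) + 1 := (norm_add_le _ _).trans (add_le_add e1 e2)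
    calc _ ≤ (W * (δ * ‖z‖) + 1) ^ 2 := by gcongr
      _ ≤ _ := by nlinarith [sq_nonneg (W * (δ * ‖z‖) - 1)]

/-- Bounds on balls that are uniform in the radius give global Gaussian integrability. Since t ≤ 1 +
t², the square of e^{δt/4} is at most e^{δ/2} e^{δt²/2}, so an exponential rate follows. -/
theorem memLp_exp_mul {u : L2Space N} {δ : ℝ} (hδ : 0 < δ) {I : ℝ}
    (h : ∀ m : ℕ, 0 < m → ∫ z in Metric.closedBall (0 : RN N) m,
      Real.exp (δ / 2 * ‖z‖ ^ 2) * ‖u z‖ ^ 2 ≤ I) :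
    MemLp (fun z : RN N => (Real.exp (δ / 4 * ‖z‖) : ℂ) * u z) 2 volume := by
  have hu : Integrable (fun z => ‖u z‖ ^ 2) volume := (Lp.memLp u).norm.integrable_sq
  have hI : Integrable (fun z => Real.exp (δ / 2 * ‖z‖ ^ 2) * ‖u z‖ ^ 2) volume := by
    refine (aecover_closedBall (μ := (volume : Measure (RN N))) (x := 0)
      (tendsto_natCast_atTop_atTop (R := ℝ))).integrable_of_integral_norm_bounded I (fun m => ?_) ?_
    · refine hu.integrableOn.bdd_mul (c := Real.exp (δ / 2 * (m : ℝ) ^ 2))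
        (Continuous.aestronglyMeasurable (by fun_prop)) ?_
      refine (ae_restrict_iff' measurableSet_closedBall).2 (Eventually.of_forall fun z hz => ?_)
      rw [Real.norm_of_nonneg (Real.exp_pos _).le]
      have : ‖z‖ ≤ m := by simpa using hz
      gcongr
    · filter_upwards [eventually_gt_atTop 0] with m hm
      refine (le_of_eq ?_).trans (h m hm)
      refine integral_congr_ae (Eventually.of_forall fun z => ?_)
      exact Real.norm_of_nonneg (by positivity)
  have hmeas : AEStronglyMeasurable (fun z : RN N => (Real.exp (δ / 4 * ‖z‖) : ℂ) * u z) volume :=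
    (Continuous.aestronglyMeasurable (by fun_prop)).mul (Lp.memLp u).1
  rw [memLp_two_iff_integrable_sq_norm hmeas]
  refine (hI.const_mul (Real.exp (δ / 2))).mono' (hmeas.norm.pow 2) (Eventually.of_forall fun z => ?_)
  rw [Real.norm_of_nonneg (by positivity), norm_mul, mul_pow, Complex.norm_real,
    Real.norm_of_nonneg (Real.exp_pos _).le, ← mul_assoc, ← Real.exp_add, ← Real.exp_nat_mul]
  gcongr
  push_cast
  nlinarith [sq_nonneg (‖z‖ - 1), norm_nonneg z]

/-- Eigenfunctions of the homogenized operator decay exponentially. -/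
theorem exists_exponential_decay {A D : Matrix (Fin N) (Fin N) ℝ} {B : Matrix (Fin N) (Fin N) ℂ}
    {κ : ℝ} (hκ : 0 < κ) (hco : SymbolCoercive A B D κ) (hB : ∀ j k, (B j k).re = 0) {c σ : ℂ}
    {φ : L2Space N} (hT : HomogenizedOp A B c D φ (σ • φ)) :
    ∃ γ : ℝ, 0 < γ ∧
        MemLp (fun z : RN N => (Real.exp (γ * ‖z‖) : ℂ) * φ z) 2 volume ∧
        ∃ g : Fin N → L2Space N, IsWeakGradient φ g ∧
          ∀ j, MemLp (fun z : RN N => (Real.exp (γ * ‖z‖) : ℂ) * g j z) 2 volume := by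
  obtain ⟨g, hg, hT⟩ := hT
  set s := (σ - c).re with hs
  set C := 2 * (∑ j, ∑ k, |A j k|) ^ 2 / κ with hCdef
  have hC0 : 0 ≤ C := by positivity
  -- The choice ensures 2Cδ² ≤ κ/4, so that the growth |∇W|² ≤ 2δ²|z|²W² + 2 consumes only half of
  -- the available confinement κ/2.
  set δ := min 1 (κ / (8 * (C + 1))) with hδdef
  have hδ : 0 < δ := lt_min one_pos (by positivity)
  have hδC : 2 * C * δ ^ 2 ≤ κ / 4 := by
    have e1 : δ ^ 2 ≤ δ := by
      have : δ ≤ 1 := min_le_left _ _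
      nlinarith
    have e2 : δ * (8 * (C + 1)) ≤ κ := by
      rw [← le_div_iff₀ (by positivity)]; exact min_le_right _ _
    nlinarith
  -- Where |z|² ≥ R2, the remaining confinement κ|z|²/4 dominates |s| + 1. Where |z|² < R2, the
  -- weight satisfies W² ≤ e^{δ R2}, which produces the constant `K`.
  set R2 := 4 * (|s| + 1) / κ with hR2
  set K := (|s| + 1) * Real.exp (δ * R2) with hK
  have hK0 : 0 ≤ K := by positivity
  have hφ : Integrable (fun z => ‖φ z‖ ^ 2) volume := (Lp.memLp φ).norm.integrable_sq
  -- The essential point is that the right side does not depend on m.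
  have main : ∀ m : ℕ, 0 < m → ∃ W : RN N → ℝ,
      (∀ z, ‖z‖ ≤ m → Real.exp (δ / 2 * ‖z‖ ^ 2) ≤ W z ^ 2) ∧
      Integrable (fun z => W z ^ 2 * ‖φ z‖ ^ 2) volume ∧
      (Integrable (fun z => W z ^ 2 * ∑ j, ‖g j z‖ ^ 2) volume) ∧
      κ / 2 * (∫ z, W z ^ 2 * ∑ j, ‖g j z‖ ^ 2) + ∫ z, W z ^ 2 * ‖φ z‖ ^ 2 ≤
        (K + 2 * C) * ∫ z, ‖φ z‖ ^ 2 := by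
    intro m hm
    obtain ⟨W, w1, w2, w3, w4, w5⟩ := exists_weight (N := N) hδ (m := m) (by exact_mod_cast hm)
    obtain ⟨i0, i4, he⟩ := energy_le hκ hco hB hg hT w1 w2
    have hWc := w1.continuous
    have hcpt : ∀ a : RN N → ℝ, Continuous a → HasCompactSupport a →
        Integrable (fun z => a z * ‖φ z‖ ^ 2) volume := by
      intro a ha hac
      obtain ⟨C', hC'⟩ := ha.bounded_above_of_compact_support hac
      exact hφ.bdd_mul (c := C') ha.aestronglyMeasurable (Eventually.of_forall hC')
    have hW2 : HasCompactSupport fun z => W z ^ 2 := w2.comp_left (g := fun t => t ^ 2) (by simp)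
    have i1 : Integrable (fun z => W z ^ 2 * ‖φ z‖ ^ 2) volume := hcpt _ (by fun_prop) hW2
    have i2 : Integrable (fun z => (W z ^ 2 * ‖z‖ ^ 2) * ‖φ z‖ ^ 2) volume :=
      hcpt _ (by fun_prop) hW2.mul_right
    have i3 : Integrable (fun z => W z ^ 2 * ∑ j, ‖g j z‖ ^ 2) volume := by
      refine (i0.sub i2).congr (Eventually.of_forall fun z => ?_)
      simp only [Pi.sub_apply]
      ring
    refine ⟨W, w4, i1, i3, ?_⟩
    have hpt : ∀ z, (s * W z ^ 2 + C * ‖fderiv ℝ W z‖ ^ 2) * ‖φ z‖ ^ 2 ≤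
        κ / 2 * ((W z ^ 2 * ‖z‖ ^ 2) * ‖φ z‖ ^ 2) - W z ^ 2 * ‖φ z‖ ^ 2
          + (K + 2 * C) * ‖φ z‖ ^ 2 := by
      intro z
      have e1 : C * ‖fderiv ℝ W z‖ ^ 2 ≤ κ / 4 * (W z ^ 2 * ‖z‖ ^ 2) + 2 * C := by
        calc C * ‖fderiv ℝ W z‖ ^ 2 ≤ C * (2 * δ ^ 2 * ‖z‖ ^ 2 * W z ^ 2 + 2) := by
              gcongr; exact w5 z
          _ = (2 * C * δ ^ 2) * (W z ^ 2 * ‖z‖ ^ 2) + 2 * C := by ring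
          _ ≤ _ := by gcongr
      have e2 : (s + 1) * W z ^ 2 ≤ κ / 4 * (W z ^ 2 * ‖z‖ ^ 2) + K := by
        have e3 : (s + 1) * W z ^ 2 ≤ (|s| + 1) * W z ^ 2 := by
          gcongr; exact le_abs_self s
        refine e3.trans ?_
        rcases le_or_gt R2 (‖z‖ ^ 2) with h | h
        · have e4 : |s| + 1 ≤ κ / 4 * ‖z‖ ^ 2 := by
            rw [hR2, div_le_iff₀ hκ] at h; linarith
          calc (|s| + 1) * W z ^ 2 ≤ κ / 4 * ‖z‖ ^ 2 * W z ^ 2 := by gcongr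
            _ ≤ _ := by linarith
        · have e4 : W z ^ 2 ≤ Real.exp (δ * R2) := (w3 z).trans (by gcongr)
          calc (|s| + 1) * W z ^ 2 ≤ K := by rw [hK]; gcongr
            _ ≤ _ := by
              have : 0 ≤ κ / 4 * (W z ^ 2 * ‖z‖ ^ 2) := by positivity
              linarith
      have e5 : s * W z ^ 2 + C * ‖fderiv ℝ W z‖ ^ 2 ≤
          κ / 2 * (W z ^ 2 * ‖z‖ ^ 2) - W z ^ 2 + (K + 2 * C) := by linarith
      calc _ ≤ (κ / 2 * (W z ^ 2 * ‖z‖ ^ 2) - W z ^ 2 + (K + 2 * C)) * ‖φ z‖ ^ 2 := by gcongr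
        _ = _ := by ring
    have h1 := integral_mono i4 (((i2.const_mul (κ / 2)).sub i1).add (hφ.const_mul (K + 2 * C))) hpt
    rw [Pi.add_def, integral_add ((i2.const_mul (κ / 2)).sub i1) (hφ.const_mul (K + 2 * C)),
      Pi.sub_def, integral_sub (i2.const_mul (κ / 2)) i1, integral_const_mul, integral_const_mul] at h1
    have h2 : ∫ z, W z ^ 2 * (‖z‖ ^ 2 * ‖φ z‖ ^ 2 + ∑ j, ‖g j z‖ ^ 2) =
        (∫ z, (W z ^ 2 * ‖z‖ ^ 2) * ‖φ z‖ ^ 2) + ∫ z, W z ^ 2 * ∑ j, ‖g j z‖ ^ 2 := by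
      rw [← integral_add i2 i3]
      refine integral_congr_ae (Eventually.of_forall fun z => ?_)
      simp only
      ring
    rw [h2] at he
    linarith
  set J := (K + 2 * C) * ∫ z, ‖φ z‖ ^ 2 with hJ
  have hloc : ∀ (u : L2Space N) (W : RN N → ℝ) (V : RN N → ℝ) (m : ℕ),
      (∀ z, ‖z‖ ≤ m → Real.exp (δ / 2 * ‖z‖ ^ 2) ≤ W z ^ 2) →
      (∀ z, ‖u z‖ ^ 2 ≤ V z) → Integrable (fun z => W z ^ 2 * V z) volume →
      ∫ z in Metric.closedBall (0 : RN N) m, Real.exp (δ / 2 * ‖z‖ ^ 2) * ‖u z‖ ^ 2 ≤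
        ∫ z, W z ^ 2 * V z := by
    intro u W V m h1 h2 h3
    have hV0 : ∀ z, 0 ≤ V z := fun z => (sq_nonneg _).trans (h2 z)
    calc _ ≤ ∫ z in Metric.closedBall (0 : RN N) m, W z ^ 2 * V z := by
          refine integral_mono_of_nonneg (Eventually.of_forall fun z => by positivity)
            h3.integrableOn ?_
          refine (ae_restrict_iff' measurableSet_closedBall).2 (Eventually.of_forall fun z hz => ?_)
          have := h1 z (by simpa using hz)
          have := h2 z
          simp only
          gcongr
      _ ≤ _ := setIntegral_le_integral h3
          (Eventually.of_forall fun z => mul_nonneg (sq_nonneg _) (hV0 z))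
  refine ⟨δ / 4, by positivity, memLp_exp_mul hδ (I := J) fun m hm => ?_, g, hg, fun j =>
    memLp_exp_mul hδ (I := 2 / κ * J) fun m hm => ?_⟩
  · obtain ⟨W, w4, i1, i3, hW⟩ := main m hm
    refine (hloc φ W (fun z => ‖φ z‖ ^ 2) m w4 (fun _ => le_rfl) i1).trans ?_
    have : 0 ≤ κ / 2 * ∫ z, W z ^ 2 * ∑ j, ‖g j z‖ ^ 2 :=
      mul_nonneg (by positivity) (integral_nonneg fun z => by positivity)
    linarith
  · obtain ⟨W, w4, i1, i3, hW⟩ := main m hm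
    refine (hloc (g j) W (fun z => ∑ j, ‖g j z‖ ^ 2) m w4 (fun z =>
      Finset.single_le_sum (f := fun j => ‖g j z‖ ^ 2) (fun _ _ => by positivity)
        (Finset.mem_univ j)) i3).trans ?_
    have h1 : 0 ≤ ∫ z, W z ^ 2 * ‖φ z‖ ^ 2 := integral_nonneg fun z => by positivity
    have h2 : κ / 2 * (∫ z, W z ^ 2 * ∑ j, ‖g j z‖ ^ 2) ≤ J := by linarith
    calc _ = 2 / κ * (κ / 2 * ∫ z, W z ^ 2 * ∑ j, ‖g j z‖ ^ 2) := by field_simp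
      _ ≤ _ := by gcongr

/-! ### Compactness of the embedding of the form domain -/

/-- The operator `u ↦ (x ↦ K x u)` with square integrable kernel `K` is compact. -/
theorem isCompactOperator_compLp {X H : Type*} [MeasurableSpace X] {μ : Measure X}
    [NormedAddCommGroup H] [NormedSpace ℂ H] (K : Lp (H →L[ℂ] ℂ) 2 μ) :
    IsCompactOperator
      (((ContinuousLinearMap.apply ℂ ℂ : H →L[ℂ] (H →L[ℂ] ℂ) →L[ℂ] ℂ).compLpL₂ 2 μ).flip K) := by
  set L := ((ContinuousLinearMap.apply ℂ ℂ : H →L[ℂ] (H →L[ℂ] ℂ) →L[ℂ] ℂ).compLpL₂ 2 μ).flip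
    with hL
  refine Lp.induction (by norm_num) (motive := fun K => IsCompactOperator (L K)) ?_ ?_ ?_ K
  -- For a kernel with a single value on a set of finite measure, the operator is the functional `c`
  -- times an indicator, hence of rank at most one.
  · intro c s hs hμ
    have : (L (Lp.simpleFunc.indicatorConst 2 hs hμ.ne c) : H → Lp ℂ 2 μ) =
        (ContinuousLinearMap.toSpanSingleton ℂ (indicatorConstLp 2 hs hμ.ne (1 : ℂ))) ∘ c := by
      funext u
      ext1
      have h1 := ContinuousLinearMap.coeFn_compLp (ContinuousLinearMap.apply ℂ ℂ u : (H →L[ℂ] ℂ) →L[ℂ] ℂ)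
        (Lp.simpleFunc.indicatorConst 2 hs hμ.ne c : Lp (H →L[ℂ] ℂ) 2 μ)
      have h2 := indicatorConstLp_coeFn (p := 2) (hs := hs) (hμs := hμ.ne) (c := c)
      have h3 := indicatorConstLp_coeFn (p := 2) (hs := hs) (hμs := hμ.ne) (c := (1 : ℂ))
      have h4 := Lp.coeFn_smul (c u) (indicatorConstLp 2 hs hμ.ne (1 : ℂ))
      rw [Lp.simpleFunc.coe_indicatorConst] at h1
      simp only [hL, ContinuousLinearMap.flip_apply, ContinuousLinearMap.compLpL₂_apply_apply,
        Function.comp_apply, ContinuousLinearMap.toSpanSingleton_apply,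
        Lp.simpleFunc.coe_indicatorConst]
      filter_upwards [h1, h2, h3, h4] with x h1 h2 h3 h4
      rw [h1, h4, Pi.smul_apply, h2, h3]
      by_cases hx : x ∈ s <;> simp [hx]
    rw [this]
    exact (isCompactOperator_of_locallyCompactSpace_dom c).clm_comp _
  · intro f g hf hg _ h1 h2
    rw [map_add]
    exact h1.add h2
  -- The operator depends continuously on its kernel and compact operators form a closed set, so
  -- compactness passes to L² limits of kernels.
  · exact (isClosed_setOfPred_isCompactOperator (σ₁₂ := RingHom.id ℂ)).preimage L.continuous

theorem memLp_indicator_ball_of_continuous {E : Type*} [NormedAddCommGroup E] {f : RN N → E}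
    (hf : Continuous f) (R : ℝ) : MemLp ((Metric.ball (0 : RN N) R).indicator f) 2 volume := by
  rw [memLp_indicator_iff_restrict measurableSet_ball]
  obtain ⟨C, hC⟩ := (isCompact_closedBall (0 : RN N) R).exists_bound_of_continuousOn
    hf.continuousOn
  have : IsFiniteMeasure ((volume : Measure (RN N)).restrict (Metric.ball 0 R)) :=
    ⟨by rw [Measure.restrict_apply_univ]; exact measure_ball_lt_top⟩
  refine MemLp.of_bound hf.aestronglyMeasurable C ?_
  exact (ae_restrict_iff' measurableSet_ball).2 (Eventually.of_forall fun x hx =>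
    hC x (Metric.ball_subset_closedBall hx))

/-- The mollification at x is the inner product with a translate of a fixed L² function, and that
translate is continuous in x. Truncated to a ball, this is a square integrable kernel with values in
the dual of L². -/
theorem exists_compact_mollification (b : ContDiffBump (0 : RN N)) (R : ℝ) :
    ∃ T : L2Space N →L[ℂ] L2Space N, IsCompactOperator T ∧ ∀ u : L2Space N,
      T u =ᵐ[volume] (Metric.ball (0 : RN N) R).indicator (conv u (mollifier b)) := by
  have hm : MemLp (fun t => mollifier b (-t)) 2 volume :=
    memLp_two_of_test ((mollifier_contDiff b).comp contDiff_neg).continuous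
      ((mollifier_hasCompactSupport b).comp_homeomorph (Homeomorph.neg _))
  obtain ⟨F, hF, hFu⟩ := exists_continuous_shift (hm.toLp _)
  have hFx : ∀ x, F x =ᵐ[volume] fun t => mollifier b (x - t) := by
    intro x
    have h1 : (fun t => hm.toLp _ (t - x)) =ᵐ[volume] fun t => mollifier b (-(t - x)) :=
      (measurePreserving_sub_right volume x).quasiMeasurePreserving.ae_eq_comp hm.coeFn_toLp
    filter_upwards [hFu x, h1] with t h2 h3
    rw [h2]
    refine h3.trans ?_
    rw [neg_sub]
  have hK := memLp_indicator_ball_of_continuous ((innerSL ℂ).continuous.comp hF) R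
  refine ⟨_, isCompactOperator_compLp (hK.toLp _), fun u => ?_⟩
  have h1 := ContinuousLinearMap.coeFn_compLp
    (ContinuousLinearMap.apply ℂ ℂ u : (L2Space N →L[ℂ] ℂ) →L[ℂ] ℂ) (hK.toLp _)
  simp only [ContinuousLinearMap.flip_apply, ContinuousLinearMap.compLpL₂_apply_apply]
  filter_upwards [h1, hK.coeFn_toLp] with x h1 h2
  rw [h1, h2]
  by_cases hx : x ∈ Metric.ball (0 : RN N) R
  · simp only [Set.indicator_of_mem hx, ContinuousLinearMap.apply_apply, innerSL_apply_apply,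
      Function.comp_apply]
    rw [L2.inner_def, conv_apply]
    refine integral_congr_ae ?_
    filter_upwards [hFx x] with t ht
    rw [ht]
    simp [mollifier]
  · simp [Set.indicator_of_notMem hx]

/-- The `L²` norm outside of a ball is controlled by that of `z φ`. -/
theorem eLpNorm_indicator_compl_ball_le {u : L2Space N} {p : Fin N → L2Space N}
    (hp : ∀ j, ∀ᵐ z, p j z = (z j : ℂ) * u z) {R : ℝ} (hR : 0 < R) :
    eLpNorm ((Metric.ball (0 : RN N) R)ᶜ.indicator u) 2 volume ≤
      ENNReal.ofReal (R⁻¹ * ∑ j, ‖p j‖) := by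
  have h1 : ∀ᵐ z, ‖(Metric.ball (0 : RN N) R)ᶜ.indicator u z‖ ≤ R⁻¹ * ‖∑ j, ‖p j z‖‖ := by
    filter_upwards [ae_all_iff.2 hp] with z hz
    by_cases h : z ∈ Metric.ball (0 : RN N) R
    · rw [Set.indicator_of_notMem (by simpa using h), norm_zero]; positivity
    · rw [Set.indicator_of_mem (by simpa using h)]
      have h2 : R ≤ ‖z‖ := by simpa using h
      have h3 : ‖z‖ ≤ ∑ j, |z j| := by
        rw [EuclideanSpace.norm_eq]
        refine Real.sqrt_le_iff.2 ⟨by positivity, ?_⟩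
        simp only [Real.norm_eq_abs]
        exact Finset.sum_sq_le_sq_sum_of_nonneg fun _ _ => abs_nonneg _
      have h4 : ∑ j, ‖p j z‖ = (∑ j, |z j|) * ‖u z‖ := by
        rw [Finset.sum_mul]
        refine Finset.sum_congr rfl fun j _ => ?_
        rw [hz j, norm_mul, Complex.norm_real, Real.norm_eq_abs]
      rw [Real.norm_of_nonneg (by positivity), h4, inv_mul_eq_div, le_div_iff₀ hR, mul_comm]
      gcongr
      linarith
  refine (eLpNorm_le_mul_eLpNorm_of_ae_le_mul h1 2).trans ?_
  rw [ENNReal.ofReal_mul (by positivity)]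
  refine mul_le_mul_right ?_ _
  have hsum : (fun z => ∑ j, ‖p j z‖) = ∑ j, fun z => ‖p j z‖ := by
    ext z; rw [Finset.sum_apply]
  rw [hsum]
  refine (eLpNorm_sum_le (fun j _ => (Lp.memLp (p j)).1.norm) (by norm_num)).trans ?_
  rw [ENNReal.ofReal_sum_of_nonneg fun _ _ => norm_nonneg _]
  refine Finset.sum_le_sum fun j _ => ?_
  rw [eLpNorm_norm, Lp.norm_def, ENNReal.ofReal_toReal (Lp.eLpNorm_ne_top _)]

/-- A family of functions with bounded gradient and bounded `z φ` is relatively compact. -/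
theorem isCompactOperator_of_bounds {V : Type*} [NormedAddCommGroup V] [NormedSpace ℂ V]
    (i : V →L[ℂ] L2Space N) {C : ℝ} (hC : 0 ≤ C)
    (h : ∀ v, ∃ g p : Fin N → L2Space N, IsWeakGradient (i v) g ∧
      (∀ j, ∀ᵐ z, p j z = (z j : ℂ) * i v z) ∧ ∑ j, ‖g j‖ ≤ C * ‖v‖ ∧ ∑ j, ‖p j‖ ≤ C * ‖v‖) :
    IsCompactOperator i := by
  -- Mollification at scale 1/(n+1) and truncation at radius n+1 are matched: the gradient bound and
  -- the bound on zφ each give an error of at most C‖v‖/(n+1).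
  let b : ℕ → ContDiffBump (0 : RN N) := fun n =>
    ⟨1 / ((n : ℝ) + 2), 1 / ((n : ℝ) + 1), by positivity, by gcongr; norm_num⟩
  choose T hTc hT using fun n : ℕ => exists_compact_mollification (b n) ((n : ℝ) + 1)
  have hlim : Tendsto (fun n => (T n).comp i) atTop (𝓝 i) := by
    rw [tendsto_iff_norm_sub_tendsto_zero]
    have h0 : Tendsto (fun n : ℕ => 2 * C * (1 / ((n : ℝ) + 1))) atTop (𝓝 0) := by
      simpa using (tendsto_one_div_add_atTop_nhds_zero_nat (𝕜 := ℝ)).const_mul (2 * C)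
    refine squeeze_zero (fun _ => norm_nonneg _) (fun n => ?_) h0
    refine ContinuousLinearMap.opNorm_le_bound _ (by positivity) fun v => ?_
    obtain ⟨g, p, hg, hp, hgC, hpC⟩ := h v
    set u := i v with hu
    set ε : ℝ := 1 / ((n : ℝ) + 1) with hε
    have hε0 : 0 < ε := by positivity
    have e1 : eLpNorm (conv u (mollifier (b n)) - ⇑u) 2 volume ≤ ENNReal.ofReal (ε * (C * ‖v‖)) := by
      refine eLpNorm_conv_mollifier_sub_le (b n) u fun h hh =>
        (eLpNorm_shiftFun_sub_le hg h).trans ?_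
      gcongr
    have e2 : eLpNorm ((Metric.ball (0 : RN N) ((n : ℝ) + 1))ᶜ.indicator u) 2 volume ≤
        ENNReal.ofReal (ε * (C * ‖v‖)) := by
      refine (eLpNorm_indicator_compl_ball_le hp (by positivity)).trans ?_
      rw [hε, one_div]
      gcongr
    have hcm : AEStronglyMeasurable (conv u (mollifier (b n)) - ⇑u) volume :=
      (conv_contDiff u (mollifier_contDiff _)
        (mollifier_hasCompactSupport _)).continuous.aestronglyMeasurable.sub (Lp.memLp u).1
    have e3 : eLpNorm (((T n).comp i - i) v : L2Space N) 2 volume ≤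
        ENNReal.ofReal (2 * C * ε * ‖v‖) := by
      have : ⇑(((T n).comp i - i) v : L2Space N) =ᵐ[volume]
          (Metric.ball (0 : RN N) ((n : ℝ) + 1)).indicator (conv u (mollifier (b n)) - ⇑u)
            - (Metric.ball (0 : RN N) ((n : ℝ) + 1))ᶜ.indicator u := by
        rw [sub_apply, ContinuousLinearMap.comp_apply]
        filter_upwards [Lp.coeFn_sub (T n u) u, hT n u] with z h1 h2
        rw [h1, Pi.sub_apply, Pi.sub_apply, h2]
        by_cases hz : z ∈ Metric.ball (0 : RN N) ((n : ℝ) + 1)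
        · rw [Set.indicator_of_mem hz, Set.indicator_of_mem hz,
            Set.indicator_of_notMem (by simpa using hz)]
          simp
        · rw [Set.indicator_of_notMem hz, Set.indicator_of_notMem hz, Set.indicator_of_mem hz]
      rw [eLpNorm_congr_ae this]
      refine (eLpNorm_sub_le (hcm.indicator measurableSet_ball)
        ((Lp.memLp u).1.indicator measurableSet_ball.compl) (by norm_num)).trans ?_
      calc _ ≤ ENNReal.ofReal (ε * (C * ‖v‖)) + ENNReal.ofReal (ε * (C * ‖v‖)) :=
            add_le_add ((eLpNorm_indicator_le _).trans e1) e2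
        _ = _ := by
          rw [← ENNReal.ofReal_add (by positivity) (by positivity)]
          congr 1; ring
    rw [Lp.norm_def]
    exact ENNReal.toReal_le_of_le_ofReal (by positivity) e3
  exact isCompactOperator_of_tendsto hlim (Eventually.of_forall fun n => (hTc n).comp_clm i)

/-! ### The form domain and the resolvent -/

/-- Integration against an `L²` function, as a bounded functional on `L²`. -/
def pairing {f : RN N → ℂ} (hf : MemLp f 2 volume) : L2Space N →L[ℂ] ℂ :=
  innerSL ℂ (hf.star.toLp _)

theorem pairing_apply {f : RN N → ℂ} (hf : MemLp f 2 volume) (u : L2Space N) :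
    pairing hf u = ∫ z, u z * f z := by
  rw [pairing, innerSL_apply_apply, L2.inner_def]
  refine integral_congr_ae ?_
  filter_upwards [hf.star.coeFn_toLp] with z hz
  rw [hz]; simp

/-- Smooth compactly supported functions. -/
abbrev SmoothTest (N : ℕ) : Type := {η : RN N → ℂ // ContDiff ℝ ∞ η ∧ HasCompactSupport η}

theorem SmoothTest.memLp (η : SmoothTest N) : MemLp η.1 2 volume :=
  memLp_two_of_test η.2.1.continuous η.2.2

theorem SmoothTest.memLp_fderiv (η : SmoothTest N) (j : Fin N) :
    MemLp (fun z => fderiv ℝ η.1 z (stdVec j)) 2 volume :=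
  memLp_fderiv_apply η.2.1 η.2.2 _

theorem contDiff_coord (j : Fin N) : ContDiff ℝ ∞ fun z : RN N => (z j : ℂ) :=
  Complex.ofRealCLM.contDiff.comp (EuclideanSpace.proj (𝕜 := ℝ) j).contDiff

/-- The product of a coordinate with a test function. -/
def SmoothTest.coordMul (η : SmoothTest N) (j : Fin N) : SmoothTest N :=
  ⟨fun z => (z j : ℂ) * η.1 z, (contDiff_coord j).mul η.2.1, η.2.2.mul_left⟩

theorem SmoothTest.fderiv_coordMul (η : SmoothTest N) (j k : Fin N) (z : RN N) :
    fderiv ℝ (η.coordMul j).1 z (stdVec k) =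
      (if j = k then η.1 z else 0) + (z j : ℂ) * fderiv ℝ η.1 z (stdVec k) := by
  have h := fderiv_real_mul_stdVec (W := fun z : RN N => z j)
    (EuclideanSpace.proj (𝕜 := ℝ) j).contDiff η.2.1 z (stdVec k)
  have h2 : fderiv ℝ (fun z : RN N => z j) z (stdVec k) = if j = k then 1 else 0 := by
    have : HasFDerivAt (fun z : RN N => z j) (EuclideanSpace.proj (𝕜 := ℝ) j) z :=
      (EuclideanSpace.proj (𝕜 := ℝ) j).hasFDerivAt
    rw [this.fderiv]
    simp [stdVec]
  rw [h2] at h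
  refine h.trans ?_
  split_ifs <;> simp

/-- Phase space indices: first the positions, then the momenta. -/
abbrev PhaseIdx (N : ℕ) : Type := Fin N ⊕ Fin N

/-- The Hilbert space in which the form domain is embedded. -/
abbrev FormAmbient (N : ℕ) : Type := PiLp 2 fun _ : Option (PhaseIdx N) => L2Space N

/-- The linear combination of the components of `w` with coefficients the row `b` of `S'`. -/
def formComp (S' : Matrix (PhaseIdx N) (PhaseIdx N) ℝ) (b : PhaseIdx N) :
    FormAmbient N →L[ℂ] L2Space N :=
  ∑ a, (S' b a : ℂ) • PiLp.proj 2 (fun _ => L2Space N) (some a)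

theorem formComp_apply (S' : Matrix (PhaseIdx N) (PhaseIdx N) ℝ) (b : PhaseIdx N)
    (w : FormAmbient N) : formComp S' b w = ∑ a, (S' b a : ℂ) • w (some a) := by
  rw [formComp, sum_apply]
  rfl

/-- The form domain `{φ : φ, zφ, ∇φ ∈ L²}`, realized as the closed space of the `w` with
`w none = φ` and `S' (w ∘ some) = (zφ, -i∇φ)`. -/
def formDomain (S' : Matrix (PhaseIdx N) (PhaseIdx N) ℝ) : Submodule ℂ (FormAmbient N) :=
  ⨅ (j : Fin N) (η : SmoothTest N),
    (pairing η.memLp ∘L formComp S' (Sum.inl j) -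
      pairing (η.coordMul j).memLp ∘L PiLp.proj 2 (fun _ => L2Space N) none :
        FormAmbient N →L[ℂ] ℂ).ker ⊓
    (pairing η.memLp ∘L (Complex.I • formComp S' (Sum.inr j)) +
      pairing (η.memLp_fderiv j) ∘L PiLp.proj 2 (fun _ => L2Space N) none :
        FormAmbient N →L[ℂ] ℂ).ker

theorem isClosed_formDomain (S' : Matrix (PhaseIdx N) (PhaseIdx N) ℝ) :
    IsClosed (formDomain S' : Set (FormAmbient N)) := by
  simp only [formDomain, Submodule.coe_iInf, Submodule.coe_inf]
  exact isClosed_iInter fun j => isClosed_iInter fun η =>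
    (ContinuousLinearMap.isClosed_ker _).inter (ContinuousLinearMap.isClosed_ker _)

instance (S' : Matrix (PhaseIdx N) (PhaseIdx N) ℝ) : CompleteSpace (formDomain S') :=
  (isClosed_formDomain S').completeSpace_coe

theorem mem_formDomain_iff {S' : Matrix (PhaseIdx N) (PhaseIdx N) ℝ} {w : FormAmbient N} :
    w ∈ formDomain S' ↔ ∀ (j : Fin N) (η : SmoothTest N),
      ∫ z, formComp S' (Sum.inl j) w z * η.1 z = ∫ z, w none z * ((z j : ℂ) * η.1 z) ∧
      Complex.I * ∫ z, formComp S' (Sum.inr j) w z * η.1 z =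
        -∫ z, w none z * fderiv ℝ η.1 z (stdVec j) := by
  simp only [formDomain, Submodule.mem_iInf, Submodule.mem_inf, LinearMap.mem_ker,
    ContinuousLinearMap.coe_coe, sub_apply, add_apply,
    ContinuousLinearMap.comp_apply, smul_apply, map_smul, pairing_apply,
    PiLp.proj_apply, sub_eq_zero, add_eq_zero_iff_eq_neg, smul_eq_mul]
  rfl

theorem formDomain_coord {S' : Matrix (PhaseIdx N) (PhaseIdx N) ℝ} {w : FormAmbient N}
    (hw : w ∈ formDomain S') (j : Fin N) :
    ∀ᵐ z, formComp S' (Sum.inl j) w z = (z j : ℂ) * w none z := by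
  have hloc : LocallyIntegrable (fun z => (z j : ℂ) * w none z) volume :=
    (L2Space.locallyIntegrable (w none)).continuous_mul (contDiff_coord j).continuous
  refine ae_eq_of_integral_contDiff_smul_eq (L2Space.locallyIntegrable _) hloc fun η h1 h2 => ?_
  have h := ((mem_formDomain_iff.1 hw) j ⟨fun z => (η z : ℂ), Complex.ofRealCLM.contDiff.comp h1,
    h2.comp_left Complex.ofReal_zero⟩).1
  calc _ = _ := integral_congr_ae (Eventually.of_forall fun z => ?_)
    _ = _ := h
    _ = _ := integral_congr_ae (Eventually.of_forall fun z => ?_)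
  · simp [mul_comm]
  · simp only [Complex.real_smul]; ring

theorem formDomain_gradient {S' : Matrix (PhaseIdx N) (PhaseIdx N) ℝ} {w : FormAmbient N}
    (hw : w ∈ formDomain S') :
    IsWeakGradient (w none) fun j => Complex.I • formComp S' (Sum.inr j) w := by
  intro j η h1 h2
  have h := ((mem_formDomain_iff.1 hw) j ⟨η, h1, h2⟩).2
  rw [← h, ← integral_const_mul]
  refine integral_congr_ae ?_
  filter_upwards [Lp.coeFn_smul Complex.I (formComp S' (Sum.inr j) w)] with z hz
  rw [hz, Pi.smul_apply, smul_eq_mul, mul_assoc]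

/-- The inclusion of the form domain into `L²`. -/
def formIncl (S' : Matrix (PhaseIdx N) (PhaseIdx N) ℝ) : formDomain S' →L[ℂ] L2Space N :=
  (PiLp.proj 2 (fun _ => L2Space N) none).comp (formDomain S').subtypeL

theorem isCompactOperator_formIncl (S' : Matrix (PhaseIdx N) (PhaseIdx N) ℝ) :
    IsCompactOperator (formIncl S') := by
  have hb : ∀ (b : Fin N → PhaseIdx N) (w : formDomain S'),
      ∑ j, ‖formComp S' (b j) w.1‖ ≤ (∑ j, ‖formComp S' (b j)‖) * ‖w‖ := fun b w => by
    rw [Finset.sum_mul]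
    exact Finset.sum_le_sum fun j _ => (formComp S' (b j)).le_opNorm w.1
  refine isCompactOperator_of_bounds (formIncl S')
    (C := (∑ j, ‖formComp S' (Sum.inl j)‖) + ∑ j, ‖formComp S' (Sum.inr j)‖) (by positivity)
    fun w => ⟨fun j => Complex.I • formComp S' (Sum.inr j) w.1, fun j => formComp S' (Sum.inl j) w.1,
      formDomain_gradient w.2, formDomain_coord w.2, ?_, ?_⟩
  · simp only [norm_smul, Complex.norm_I, one_mul]
    refine (hb Sum.inr w).trans ?_
    gcongr
    exact le_add_of_nonneg_left (by positivity)
  · refine (hb Sum.inl w).trans ?_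
    gcongr
    exact le_add_of_nonneg_right (by positivity)

/-- The resolvent `i i†`. -/
def formResolvent (S' : Matrix (PhaseIdx N) (PhaseIdx N) ℝ) : L2Space N →L[ℂ] L2Space N :=
  formIncl S' ∘L (ContinuousLinearMap.adjoint (formIncl S'))

theorem isCompactOperator_formResolvent (S' : Matrix (PhaseIdx N) (PhaseIdx N) ℝ) :
    IsCompactOperator (formResolvent S') :=
  (isCompactOperator_formIncl S').comp_clm _

theorem formResolvent_isSymmetric (S' : Matrix (PhaseIdx N) (PhaseIdx N) ℝ) :
    (formResolvent S' : L2Space N →ₗ[ℂ] L2Space N).IsSymmetric := by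
  intro f h
  show inner ℂ (formIncl S' (ContinuousLinearMap.adjoint (formIncl S') f)) h =
    inner ℂ f (formIncl S' (ContinuousLinearMap.adjoint (formIncl S') h))
  rw [← ContinuousLinearMap.adjoint_inner_right, ContinuousLinearMap.adjoint_inner_left]

/-- The phase space components `(z θ, -i∇θ)` of the conjugate `θ` of a test function `η`. -/
def testComp (η : SmoothTest N) : PhaseIdx N → L2Space N
  | Sum.inl j => (η.coordMul j).memLp.star.toLp _
  | Sum.inr j => (-Complex.I) • ((η.memLp_fderiv j).star.toLp _)

theorem inner_testComp_inl (η : SmoothTest N) (j : Fin N) (v : L2Space N) :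
    inner ℂ (testComp η (Sum.inl j)) v = ∫ z, v z * ((z j : ℂ) * η.1 z) :=
  pairing_apply (η.coordMul j).memLp v

theorem inner_testComp_inr (η : SmoothTest N) (j : Fin N) (v : L2Space N) :
    inner ℂ (testComp η (Sum.inr j)) v = Complex.I * ∫ z, v z * fderiv ℝ η.1 z (stdVec j) := by
  rw [← pairing_apply (η.memLp_fderiv j), testComp, inner_smul_left]
  simp only [map_neg, Complex.conj_I, neg_neg]
  rfl

/-- The element of the form domain given by the conjugate of a test function. -/
def testElem (S : Matrix (PhaseIdx N) (PhaseIdx N) ℝ) (η : SmoothTest N) : FormAmbient N :=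
  WithLp.toLp 2 fun
    | none => η.memLp.star.toLp _
    | some a => ∑ b, (S a b : ℂ) • testComp η b

theorem formComp_testElem {S S' : Matrix (PhaseIdx N) (PhaseIdx N) ℝ} (h : S' * S = 1)
    (η : SmoothTest N) (b : PhaseIdx N) : formComp S' b (testElem S η) = testComp η b := by
  rw [formComp_apply]
  simp only [testElem, Finset.smul_sum, smul_smul]
  rw [Finset.sum_comm]
  have : ∀ c, ∑ a, (S' b a : ℂ) * (S a c : ℂ) = if b = c then 1 else 0 := fun c => by
    have := congrFun (congrFun h b) c
    rw [Matrix.mul_apply, Matrix.one_apply] at this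
    rw [← Complex.ofReal_one, ← Complex.ofReal_zero, ← apply_ite Complex.ofReal, ← this]
    push_cast; rfl
  simp only [← Finset.sum_smul, this]
  simp

theorem integral_mul_fderiv_test {u η : RN N → ℂ} (hu : ContDiff ℝ ∞ u) (hη : ContDiff ℝ ∞ η)
    (hc : HasCompactSupport u) (v : RN N) :
    ∫ z, fderiv ℝ u z v * η z = -∫ z, u z * fderiv ℝ η z v := by
  have c1 := (contDiff_fderiv_apply hu v).continuous
  have c2 := (contDiff_fderiv_apply hη v).continuous
  have := integral_mul_fderiv_eq_neg_fderiv_mul_of_integrable (μ := (volume : Measure (RN N)))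
    (f := u) (g := η) (v := v)
    ((c1.mul hη.continuous).integrable_of_hasCompactSupport
      (hasCompactSupport_fderiv_apply hc v).mul_right)
    ((hu.continuous.mul c2).integrable_of_hasCompactSupport hc.mul_right)
    ((hu.continuous.mul hη.continuous).integrable_of_hasCompactSupport hc.mul_right)
    (fun x _ => (hu.differentiable (by simp)).differentiableAt)
    (fun x _ => (hη.differentiable (by simp)).differentiableAt)
  rw [this, neg_neg]

/-- Test functions must lie in the form domain for the Riesz identity to imply the weak equation.
The conjugate appears because the inner product is antilinear in its first argument while the weak
form is bilinear. -/
theorem testElem_mem {S S' : Matrix (PhaseIdx N) (PhaseIdx N) ℝ} (h : S' * S = 1)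
    (η : SmoothTest N) : testElem S η ∈ formDomain S' := by
  rw [mem_formDomain_iff]
  intro j θ
  have h0 : ∀ᵐ z, testElem S η none z = conj (η.1 z) := η.memLp.star.coeFn_toLp
  rw [formComp_testElem h, formComp_testElem h]
  constructor
  · refine integral_congr_ae ?_
    filter_upwards [h0, (η.coordMul j).memLp.star.coeFn_toLp] with z h1 h2
    have : testComp η (Sum.inl j) z = conj ((η.coordMul j).1 z) := h2
    rw [h1, this]
    simp only [SmoothTest.coordMul, map_mul, Complex.conj_ofReal]
    ring
  · have h3 : ContDiff ℝ ∞ fun z => conj (η.1 z) := Complex.conjCLE.contDiff.comp η.2.1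
    have h4 : HasCompactSupport fun z => conj (η.1 z) := η.2.2.comp_left (map_zero _)
    have h5 := integral_mul_fderiv_test h3 θ.2.1 h4 (stdVec j)
    have e1 : ∫ z, testElem S η none z * fderiv ℝ θ.1 z (stdVec j) =
        ∫ z, conj (η.1 z) * fderiv ℝ θ.1 z (stdVec j) := by
      refine integral_congr_ae ?_
      filter_upwards [h0] with z h1
      rw [h1]
    rw [e1, ← h5, ← integral_const_mul]
    refine integral_congr_ae ?_
    filter_upwards [Lp.coeFn_smul (-Complex.I) ((η.memLp_fderiv j).star.toLp _),
      (η.memLp_fderiv j).star.coeFn_toLp] with z h1 h2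
    have h6 : testComp η (Sum.inr j) z = -Complex.I * conj (fderiv ℝ η.1 z (stdVec j)) := by
      refine h1.trans ?_
      rw [Pi.smul_apply, h2]; rfl
    rw [h6, fderiv_conj_apply η.2.1]
    linear_combination (-(conj (fderiv ℝ η.1 z (stdVec j)) * θ.1 z)) * Complex.I_mul_I

/-! ### The resolvent of the homogenized operator -/

/-- A partial derivative of a test function. -/
def SmoothTest.pderiv (η : SmoothTest N) (j : Fin N) : SmoothTest N :=
  ⟨fun z => fderiv ℝ η.1 z (stdVec j), contDiff_fderiv_apply η.2.1 _,
    hasCompactSupport_fderiv_apply η.2.2 _⟩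

/-- Integration against a test function, on `L²`. -/
def SmoothTest.pair (η : SmoothTest N) : L2Space N →L[ℂ] ℂ := pairing η.memLp

theorem SmoothTest.pair_apply (η : SmoothTest N) (u : L2Space N) :
    η.pair u = ∫ z, u z * η.1 z := pairing_apply η.memLp u

theorem SmoothTest.integrable_mul (η : SmoothTest N) (u : L2Space N) :
    Integrable (fun z => u z * η.1 z) volume := (Lp.memLp u).integrable_fun_mul η.memLp

theorem SmoothTest.pair_pderiv_coordMul (η : SmoothTest N) (j k : Fin N) (u : L2Space N) :
    ((η.coordMul j).pderiv k).pair u =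
      (if j = k then η.pair u else 0) + ((η.pderiv k).coordMul j).pair u := by
  have h : ∀ z, u z * ((η.coordMul j).pderiv k).1 z =
      (if j = k then u z * η.1 z else 0) + u z * ((η.pderiv k).coordMul j).1 z := fun z => by
    show u z * fderiv ℝ (η.coordMul j).1 z (stdVec k) = _
    rw [SmoothTest.fderiv_coordMul, mul_add, mul_ite, mul_zero]
    rfl
  simp only [SmoothTest.pair_apply, h]
  split_ifs with hjk
  · exact integral_add (η.integrable_mul u) (SmoothTest.integrable_mul _ u)
  · simp

theorem IsWeakGradient.pair {φ : L2Space N} {g : Fin N → L2Space N} (hg : IsWeakGradient φ g)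
    (η : SmoothTest N) (j : Fin N) : η.pair (g j) = -(η.pderiv j).pair φ := by
  rw [SmoothTest.pair_apply, SmoothTest.pair_apply]
  exact hg j η.1 η.2.1 η.2.2

/-- The weak form of `-div(A∇φ) + div(φ B z) + c φ + (D z · z) φ`, with `g` in place of `∇φ`. -/
def weakForm (A : Matrix (Fin N) (Fin N) ℝ) (B : Matrix (Fin N) (Fin N) ℂ) (c : ℂ)
    (D : Matrix (Fin N) (Fin N) ℝ) (η : SmoothTest N) (φ : L2Space N) (g : Fin N → L2Space N) : ℂ :=
  (∑ j, ∑ k, (A j k : ℂ) * (η.pderiv j).pair (g k))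
    - (∑ j, ∑ k, B j k * ((η.pderiv j).coordMul k).pair φ)
    + c * η.pair φ
    + ∑ j, ∑ k, (D j k : ℂ) * ((η.coordMul j).coordMul k).pair φ

theorem integral_eq_weakForm (A : Matrix (Fin N) (Fin N) ℝ) (B : Matrix (Fin N) (Fin N) ℂ) (c : ℂ)
    (D : Matrix (Fin N) (Fin N) ℝ) (η : SmoothTest N) (φ : L2Space N) (g : Fin N → L2Space N) :
    ∫ z, ((∑ j, ∑ k, (A j k : ℂ) * g k z * fderiv ℝ η.1 z (stdVec j))
          - (∑ j, ∑ k, φ z * (B j k * (z k : ℂ)) * fderiv ℝ η.1 z (stdVec j))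
          + c * φ z * η.1 z
          + (∑ j, ∑ k, (D j k : ℂ) * (z k : ℂ) * (z j : ℂ)) * φ z * η.1 z) =
      weakForm A B c D η φ g := by
  have i1 : ∀ j k, Integrable (fun z => (A j k : ℂ) * (g k z * (η.pderiv j).1 z)) volume :=
    fun j k => ((η.pderiv j).integrable_mul (g k)).const_mul _
  have i2 : ∀ j k, Integrable (fun z => B j k * (φ z * ((η.pderiv j).coordMul k).1 z)) volume :=
    fun j k => (SmoothTest.integrable_mul _ φ).const_mul _
  have i3 : Integrable (fun z => c * (φ z * η.1 z)) volume := (η.integrable_mul φ).const_mul _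
  have i4 : ∀ j k, Integrable
      (fun z => (D j k : ℂ) * (φ z * ((η.coordMul j).coordMul k).1 z)) volume :=
    fun j k => (SmoothTest.integrable_mul _ φ).const_mul _
  have s1 := integrable_finsetSum Finset.univ fun j _ =>
    integrable_finsetSum Finset.univ fun k _ => i1 j k
  have s2 := integrable_finsetSum Finset.univ fun j _ =>
    integrable_finsetSum Finset.univ fun k _ => i2 j k
  have s4 := integrable_finsetSum Finset.univ fun j _ =>
    integrable_finsetSum Finset.univ fun k _ => i4 j k
  have e : ∀ (F : Fin N → Fin N → RN N → ℂ), (∀ j k, Integrable (F j k) volume) →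
      ∫ z, ∑ j, ∑ k, F j k z = ∑ j, ∑ k, ∫ z, F j k z := fun F hF => by
    rw [integral_finsetSum _ fun j _ => integrable_finsetSum _ fun k _ => hF j k]
    exact Finset.sum_congr rfl fun j _ => integral_finsetSum _ fun k _ => hF j k
  calc _ = ∫ z, ((∑ j, ∑ k, (A j k : ℂ) * (g k z * (η.pderiv j).1 z))
          - (∑ j, ∑ k, B j k * (φ z * ((η.pderiv j).coordMul k).1 z))
          + c * (φ z * η.1 z)
          + ∑ j, ∑ k, (D j k : ℂ) * (φ z * ((η.coordMul j).coordMul k).1 z)) := by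
        refine integral_congr_ae (Eventually.of_forall fun z => ?_)
        simp only [SmoothTest.pderiv, SmoothTest.coordMul, Finset.sum_mul]
        congr 1
        · congr 1
          · congr 1
            · exact Finset.sum_congr rfl fun j _ => Finset.sum_congr rfl fun k _ => by ring
            · exact Finset.sum_congr rfl fun j _ => Finset.sum_congr rfl fun k _ => by ring
          · ring
        · exact Finset.sum_congr rfl fun j _ => Finset.sum_congr rfl fun k _ => by ring
    _ = _ := by
        have s12 : Integrable (fun z => (∑ j, ∑ k, (A j k : ℂ) * (g k z * (η.pderiv j).1 z))
            - ∑ j, ∑ k, B j k * (φ z * ((η.pderiv j).coordMul k).1 z)) volume := s1.sub s2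
        have s123 : Integrable (fun z => (∑ j, ∑ k, (A j k : ℂ) * (g k z * (η.pderiv j).1 z))
            - (∑ j, ∑ k, B j k * (φ z * ((η.pderiv j).coordMul k).1 z))
            + c * (φ z * η.1 z)) volume := s12.add i3
        rw [integral_add s123 s4, integral_add s12 i3, integral_sub s1 s2,
          e _ i1, e _ i2, e _ i4]
        simp only [integral_const_mul, ← SmoothTest.pair_apply]
        rfl

theorem homogenizedOp_iff {A : Matrix (Fin N) (Fin N) ℝ} {B : Matrix (Fin N) (Fin N) ℂ} {c : ℂ}
    {D : Matrix (Fin N) (Fin N) ℝ} {φ f : L2Space N} :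
    HomogenizedOp A B c D φ f ↔ ∃ g : Fin N → L2Space N, IsWeakGradient φ g ∧
      ∀ η : SmoothTest N, weakForm A B c D η φ g = η.pair f := by
  refine exists_congr fun g => and_congr_right fun _ => ⟨fun h η => ?_, fun h η h1 h2 => ?_⟩
  · rw [← integral_eq_weakForm, h η.1 η.2.1 η.2.2, SmoothTest.pair_apply]
  · rw [integral_eq_weakForm A B c D ⟨η, h1, h2⟩, h, SmoothTest.pair_apply]

theorem HomogenizedOp.sub {A : Matrix (Fin N) (Fin N) ℝ} {B : Matrix (Fin N) (Fin N) ℂ} {c : ℂ}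
    {D : Matrix (Fin N) (Fin N) ℝ} {φ φ' f f' : L2Space N} (h : HomogenizedOp A B c D φ f)
    (h' : HomogenizedOp A B c D φ' f') : HomogenizedOp A B c D (φ - φ') (f - f') := by
  rw [homogenizedOp_iff] at h h' ⊢
  obtain ⟨g, hg, h⟩ := h
  obtain ⟨g', hg', h'⟩ := h'
  refine ⟨_, hg.sub hg', fun η => ?_⟩
  rw [map_sub, ← h η, ← h' η]
  simp only [weakForm, Pi.sub_apply, map_sub, mul_sub, Finset.sum_sub_distrib]
  ring

theorem SmoothTest.eq_zero_of_pair {f : L2Space N} (h : ∀ η : SmoothTest N, η.pair f = 0) :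
    f = 0 := by
  refine (Lp.eq_zero_iff_ae_eq_zero).2 (ae_eq_zero_of_integral_contDiff_smul_eq_zero
    (L2Space.locallyIntegrable f) fun η h1 h2 => ?_)
  have := h ⟨fun z => (η z : ℂ), Complex.ofRealCLM.contDiff.comp h1,
    h2.comp_left Complex.ofReal_zero⟩
  rw [SmoothTest.pair_apply] at this
  rw [← this]
  refine integral_congr_ae (Eventually.of_forall fun z => ?_)
  simp [mul_comm]

/-- The weak gradient of 0 is 0, so every term of the weak form vanishes. This excludes 0 as an
eigenvalue of the resolvent. -/
theorem HomogenizedOp.eq_zero {A : Matrix (Fin N) (Fin N) ℝ} {B : Matrix (Fin N) (Fin N) ℂ} {c : ℂ}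
    {D : Matrix (Fin N) (Fin N) ℝ} {f : L2Space N} (h : HomogenizedOp A B c D 0 f) : f = 0 := by
  obtain ⟨g, hg, h⟩ := homogenizedOp_iff.1 h
  have hg0 : ∀ k, g k = 0 := fun k => SmoothTest.eq_zero_of_pair fun η => by
    rw [hg.pair, map_zero, neg_zero]
  refine SmoothTest.eq_zero_of_pair fun η => ?_
  rw [← h η]
  simp [weakForm, hg0]

theorem formDomain_pair {S' : Matrix (PhaseIdx N) (PhaseIdx N) ℝ} {w : FormAmbient N}
    (hw : w ∈ formDomain S') (η : SmoothTest N) (k : Fin N) :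
    η.pair (formComp S' (Sum.inl k) w) = (η.coordMul k).pair (w none) ∧
      Complex.I * η.pair (formComp S' (Sum.inr k) w) = -(η.pderiv k).pair (w none) := by
  simp only [SmoothTest.pair_apply]
  exact mem_formDomain_iff.1 hw k η

theorem sum_smul_formComp {S' P M : Matrix (PhaseIdx N) (PhaseIdx N) ℝ} (h : M * S' = P)
    (w : FormAmbient N) (b : PhaseIdx N) :
    ∑ c, (M b c : ℂ) • formComp S' c w = ∑ a, (P b a : ℂ) • w (some a) := by
  simp only [formComp_apply, Finset.smul_sum, smul_smul]
  rw [Finset.sum_comm]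
  refine Finset.sum_congr rfl fun a _ => ?_
  rw [← Finset.sum_smul, ← h, Matrix.mul_apply]
  push_cast
  rfl

/-- The adjoint of S is moved onto `w`: the components of `w` beyond the first are S Pφ, and Sᵀ = M
S' replaces them by M applied to Pφ. -/
theorem inner_testElem {S S' M : Matrix (PhaseIdx N) (PhaseIdx N) ℝ} (h : M * S' = S.transpose)
    (η : SmoothTest N) (w : FormAmbient N) :
    inner ℂ (testElem S η) w = η.pair (w none) +
      ∑ b, ∑ c, (M b c : ℂ) * inner ℂ (testComp η b) (formComp S' c w) := by
  have h1 : ∀ b, ∑ c, (M b c : ℂ) * inner ℂ (testComp η b) (formComp S' c w) =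
      ∑ a, (S a b : ℂ) * inner ℂ (testComp η b) (w (some a)) := fun b => by
    have := congrArg (fun v => inner ℂ (testComp η b) v) (sum_smul_formComp h w b)
    simpa only [inner_sum, inner_smul_right, Matrix.transpose_apply] using this
  rw [PiLp.inner_apply, Fintype.sum_option]
  congr 1
  simp only [h1]
  rw [Finset.sum_comm]
  refine Finset.sum_congr rfl fun a _ => ?_
  show inner ℂ (∑ b, (S a b : ℂ) • testComp η b) (w (some a)) = _
  simp only [sum_inner, inner_smul_left, Complex.conj_ofReal]

/-- Evaluating ⟨θ, i†f⟩ = ⟨iθ, f⟩ at conjugates θ of test functions gives the weak form of (P·MP +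
1)φ = f. Commuting the derivatives past z in the mixed block doubles the B term and leaves the trace
of that block, which accounts for the spectral shift c - 1 - i tr M₂₁. -/
theorem homogenizedOp_formResolvent {S S' M : Matrix (PhaseIdx N) (PhaseIdx N) ℝ}
    (hS : S' * S = 1) (h : M * S' = S.transpose) (hM : M.transpose = M) (c : ℂ) (f : L2Space N) :
    HomogenizedOp M.toBlocks₂₂ ((-2 * Complex.I) • M.toBlocks₂₁.map Complex.ofReal) c M.toBlocks₁₁
      (formResolvent S' f)
      (f + (c - 1 - Complex.I * (M.toBlocks₂₁.trace : ℂ)) • formResolvent S' f) := by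
  obtain ⟨w, hw⟩ : ∃ w, w = ContinuousLinearMap.adjoint (formIncl S') f := ⟨_, rfl⟩
  have hR : formResolvent S' f = w.1 none := by rw [hw]; rfl
  rw [hR, homogenizedOp_iff]
  refine ⟨_, formDomain_gradient w.2, fun η => ?_⟩
  have key : inner ℂ (testElem S η) w.1 = η.pair f := by
    have := ContinuousLinearMap.adjoint_inner_right (formIncl S') ⟨_, testElem_mem hS η⟩ f
    rw [← hw] at this
    exact this
  have hsymm : ∀ j k, M (Sum.inl j) (Sum.inr k) = M.toBlocks₂₁ k j := fun j k =>
    congrFun (congrFun hM (Sum.inr k)) (Sum.inl j)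
  rw [inner_testElem h] at key
  have hl : ∀ j v, inner ℂ (testComp η (Sum.inl j)) v = (η.coordMul j).pair v := fun j v =>
    (inner_testComp_inl η j v).trans (SmoothTest.pair_apply (η.coordMul j) v).symm
  have hr : ∀ j v, inner ℂ (testComp η (Sum.inr j)) v = Complex.I * (η.pderiv j).pair v :=
    fun j v => (inner_testComp_inr η j v).trans (by rw [SmoothTest.pair_apply]; rfl)
  -- The derivative is moved onto z_j η; the Kronecker delta from ∂_k z_j is the source of the
  -- trace.
  have e1 : ∀ j k, (η.coordMul j).pair (formComp S' (Sum.inr k) w.1) =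
      Complex.I * ((if j = k then η.pair (w.1 none) else 0) +
        ((η.pderiv k).coordMul j).pair (w.1 none)) := fun j k => by
    rw [← SmoothTest.pair_pderiv_coordMul]
    linear_combination (-Complex.I) * (formDomain_pair w.2 (η.coordMul j) k).2 +
      ((η.coordMul j).pair (formComp S' (Sum.inr k) w.1)) * Complex.I_mul_I
  simp only [Fintype.sum_sum_type, hl, hr, e1, (formDomain_pair w.2 _ _).1, hsymm] at key
  rw [map_add, map_smul, ← key]
  have e2 : ∑ j, ∑ k, (M.toBlocks₂₁ k j : ℂ) * (Complex.I *
      ((if j = k then η.pair (w.1 none) else 0) + ((η.pderiv k).coordMul j).pair (w.1 none))) =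
      Complex.I * (M.toBlocks₂₁.trace : ℂ) * η.pair (w.1 none) +
      ∑ j, ∑ k, (M.toBlocks₂₁ j k : ℂ) * (Complex.I *
        ((η.pderiv j).coordMul k).pair (w.1 none)) := by
    simp only [mul_add, Finset.sum_add_distrib]
    congr 1
    · simp only [mul_ite, mul_zero, Finset.sum_ite_eq, Finset.mem_univ, if_true]
      rw [Matrix.trace, Complex.ofReal_sum, Finset.mul_sum, Finset.sum_mul]
      exact Finset.sum_congr rfl fun j _ => by rw [Matrix.diag_apply]; ring
    · exact Finset.sum_comm
  simp only [Finset.sum_add_distrib, e2, weakForm, map_smul, smul_eq_mul, Matrix.smul_apply,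
    Matrix.map_apply]
  have e3 : ∑ j, ∑ k, -2 * Complex.I * (M.toBlocks₂₁ j k : ℂ) *
      ((η.pderiv j).coordMul k).pair (w.1 none) = -2 * ∑ j, ∑ k, (M.toBlocks₂₁ j k : ℂ) *
        (Complex.I * ((η.pderiv j).coordMul k).pair (w.1 none)) := by
    simp only [Finset.mul_sum]
    exact Finset.sum_congr rfl fun j _ => Finset.sum_congr rfl fun k _ => by ring
  rw [e3]
  simp only [Matrix.toBlocks₁₁, Matrix.toBlocks₂₂, Matrix.toBlocks₂₁, Matrix.of_apply]
  ring

/-! ### Coercivity -/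

/-- Write v = S'(Sv) and apply the Cauchy-Schwarz inequality to each row; the constant is the
squared Hilbert-Schmidt norm of S'. -/
theorem sum_norm_sq_le_mulVec {ι : Type*} [Fintype ι] [DecidableEq ι] {S S' : Matrix ι ι ℝ}
    (hS : S' * S = 1) (v : ι → ℂ) :
    ∑ b, ‖v b‖ ^ 2 ≤ (∑ b, ∑ a, S' b a ^ 2) * ∑ a, ‖∑ b, (S a b : ℂ) * v b‖ ^ 2 := by
  rw [Finset.sum_mul]
  refine Finset.sum_le_sum fun b _ => ?_
  have h1 : v b = ∑ a, (S' b a : ℂ) * ∑ c, (S a c : ℂ) * v c := by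
    simp only [Finset.mul_sum, ← mul_assoc]
    rw [Finset.sum_comm]
    simp only [← Finset.sum_mul]
    have : ∀ c, ∑ a, (S' b a : ℂ) * (S a c : ℂ) = if b = c then 1 else 0 := fun c => by
      have := congrFun (congrFun hS b) c
      rw [Matrix.mul_apply, Matrix.one_apply] at this
      rw [← Complex.ofReal_one, ← Complex.ofReal_zero, ← apply_ite Complex.ofReal, ← this]
      push_cast; rfl
    simp [this]
  have h2 : ‖v b‖ ≤ ∑ a, |S' b a| * ‖∑ c, (S a c : ℂ) * v c‖ := by
    conv_lhs => rw [h1]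
    refine (norm_sum_le _ _).trans (le_of_eq (Finset.sum_congr rfl fun a _ => ?_))
    rw [norm_mul, Complex.norm_real, Real.norm_eq_abs]
  calc ‖v b‖ ^ 2 ≤ (∑ a, |S' b a| * ‖∑ c, (S a c : ℂ) * v c‖) ^ 2 := by gcongr
    _ ≤ (∑ a, |S' b a| ^ 2) * ∑ a, ‖∑ c, (S a c : ℂ) * v c‖ ^ 2 :=
      Finset.sum_mul_sq_le_sq_mul_sq _ _ _
    _ = _ := by simp only [sq_abs]

/-- With v = (zφ, -ig), the symbol and the Hermitian form of M at v, which equals |Sv|², differ by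
i(X + X̄), a purely imaginary number. Coercivity then follows from invertibility of S; the summand 1
in the constant only secures positivity. -/
theorem symbolCoercive_of_factor {S S' M : Matrix (PhaseIdx N) (PhaseIdx N) ℝ}
    (hS : S' * S = 1) (h : S.transpose * S = M) :
    SymbolCoercive M.toBlocks₂₂ ((-2 * Complex.I) • M.toBlocks₂₁.map Complex.ofReal) M.toBlocks₁₁
      (1 + ∑ b, ∑ a, S' b a ^ 2)⁻¹ := by
  intro φ g z
  set v : PhaseIdx N → ℂ := Sum.elim (fun j => (z j : ℂ) * φ) (fun j => -Complex.I * g j) with hv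
  have hsymm : ∀ j k, M (Sum.inl j) (Sum.inr k) = M.toBlocks₂₁ k j := fun j k => by
    have : M.transpose = M := by rw [← h, Matrix.transpose_mul, Matrix.transpose_transpose]
    exact congrFun (congrFun this (Sum.inr k)) (Sum.inl j)
  have hnorm : ∑ b, ‖v b‖ ^ 2 = ‖z‖ ^ 2 * ‖φ‖ ^ 2 + ∑ j, ‖g j‖ ^ 2 := by
    rw [Fintype.sum_sum_type, EuclideanSpace.norm_sq_eq, Finset.sum_mul]
    simp [hv, mul_pow]
  have hQ : ((∑ a, ‖∑ b, (S a b : ℂ) * v b‖ ^ 2 : ℝ) : ℂ) =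
      ∑ b, ∑ c, (M b c : ℂ) * v c * conj (v b) := by
    have : ∀ b c, (M b c : ℂ) = ∑ a, (S a b : ℂ) * (S a c : ℂ) := fun b c => by
      rw [← h, Matrix.mul_apply]; push_cast; rfl
    simp only [this, Finset.sum_mul]
    rw [Finset.sum_congr rfl fun b _ => Finset.sum_comm, Finset.sum_comm]
    push_cast
    refine Finset.sum_congr rfl fun a _ => ?_
    rw [← Complex.mul_conj', map_sum, Finset.sum_mul_sum, Finset.sum_comm]
    refine Finset.sum_congr rfl fun b _ => Finset.sum_congr rfl fun c _ => ?_
    rw [map_mul, Complex.conj_ofReal]; ring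
  set X : ℂ := ∑ j, ∑ k, (M.toBlocks₂₁ j k : ℂ) * (z k : ℂ) * φ * conj (g j) with hX
  have hXc : conj X = ∑ j, ∑ k, (M.toBlocks₂₁ j k : ℂ) * (z k : ℂ) * conj φ * g j := by
    simp [hX, map_sum, map_mul]
  have hE : (∑ j, ((∑ k, (M.toBlocks₂₂ j k : ℂ) * g k) - φ * ∑ k,
        ((-2 * Complex.I) • M.toBlocks₂₁.map Complex.ofReal) j k * (z k : ℂ)) * conj (g j)) +
        (∑ j, ∑ k, (M.toBlocks₁₁ j k : ℂ) * (z k : ℂ) * (z j : ℂ)) * φ * conj φ =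
      (∑ b, ∑ c, (M b c : ℂ) * v c * conj (v b)) + Complex.I * (X + conj X) := by
    have e1 : ∑ j, ((∑ k, (M.toBlocks₂₂ j k : ℂ) * g k) - φ * ∑ k,
        ((-2 * Complex.I) • M.toBlocks₂₁.map Complex.ofReal) j k * (z k : ℂ)) * conj (g j) =
        (∑ j, ∑ k, (M.toBlocks₂₂ j k : ℂ) * g k * conj (g j)) + 2 * Complex.I * X := by
      simp only [sub_mul, Finset.sum_sub_distrib, Finset.sum_mul, Finset.mul_sum, hX]
      rw [sub_eq_add_neg, ← Finset.sum_neg_distrib]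
      simp only [← Finset.sum_neg_distrib, Matrix.smul_apply, Matrix.map_apply, smul_eq_mul]
      congr 1
      exact Finset.sum_congr rfl fun j _ => Finset.sum_congr rfl fun k _ => by ring
    have e2 : ∑ b, ∑ c, (M b c : ℂ) * v c * conj (v b) =
        (∑ j, ∑ k, (M.toBlocks₁₁ j k : ℂ) * (z k : ℂ) * (z j : ℂ)) * φ * conj φ
        + Complex.I * X + (-(Complex.I * conj X) +
        ∑ j, ∑ k, (M.toBlocks₂₂ j k : ℂ) * g k * conj (g j)) := by
      simp only [Fintype.sum_sum_type, Finset.sum_add_distrib, hsymm, hv, Sum.elim_inl,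
        Sum.elim_inr, map_mul, map_neg, Complex.conj_I, Complex.conj_ofReal, neg_neg]
      congr 1
      · congr 1
        · simp only [Finset.sum_mul]
          refine Finset.sum_congr rfl fun j _ => Finset.sum_congr rfl fun k _ => ?_
          simp only [Matrix.toBlocks₁₁, Matrix.of_apply]; ring
        · rw [hX]
          simp only [Finset.mul_sum]
          refine Finset.sum_congr rfl fun j _ => Finset.sum_congr rfl fun k _ => ?_
          simp only [Matrix.toBlocks₂₁, Matrix.of_apply]; ring
      · congr 1
        · rw [hXc, Finset.sum_comm, ← neg_mul, Finset.mul_sum]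
          simp only [Finset.mul_sum]
          refine Finset.sum_congr rfl fun j _ => Finset.sum_congr rfl fun k _ => ?_
          ring
        · refine Finset.sum_congr rfl fun j _ => Finset.sum_congr rfl fun k _ => ?_
          simp only [Matrix.toBlocks₂₂, Matrix.of_apply]
          linear_combination (-(M (Sum.inr j) (Sum.inr k) : ℂ) * g k * conj (g j)) * Complex.I_mul_I
    rw [e1, e2]; ring
  rw [hE, ← hQ, Complex.add_conj, ← hnorm]
  have h0 : 0 ≤ ∑ b, ∑ a, S' b a ^ 2 := by positivity
  have h3 := sum_norm_sq_le_mulVec hS v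
  have h4 : 0 ≤ ∑ a, ‖∑ b, (S a b : ℂ) * v b‖ ^ 2 := by positivity
  rw [inv_mul_le_iff₀ (by positivity)]
  simp only [Complex.add_re, Complex.ofReal_re, Complex.mul_re, Complex.I_re, Complex.I_im,
    Complex.ofReal_im, zero_mul, mul_zero, sub_zero, add_zero]
  linarith

/-- A positive matrix has the form S*S, and det M = (det S)² > 0 makes S invertible. -/
theorem exists_factor {ι : Type*} [Fintype ι] [DecidableEq ι] {M : Matrix ι ι ℝ} (hM : M.PosDef) :
    ∃ S S' : Matrix ι ι ℝ, S' * S = 1 ∧ S * S' = 1 ∧ S.transpose * S = M := by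
  open scoped MatrixOrder in
  obtain ⟨S, hS⟩ := CStarAlgebra.nonneg_iff_eq_star_mul_self.1 hM.posSemidef.nonneg
  have hS' : S.transpose * S = M := by
    rw [hS, Matrix.star_eq_conjTranspose, Matrix.conjTranspose_eq_transpose_of_trivial]
  have hdet : IsUnit S.det := by
    have := hM.det_pos
    rw [← hS', Matrix.det_mul, Matrix.det_transpose] at this
    exact isUnit_iff_ne_zero.2 fun h => by simp [h] at this
  exact ⟨S, S⁻¹, Matrix.nonsing_inv_mul _ hdet, Matrix.mul_nonsing_inv _ hdet, hS'⟩

/-- By the resolvent identity R = R₀(1 + (μ - μ₀)R), every resolvent is a compact operator composed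
with a bounded one. -/
theorem hasCompactResolvent_of_isResolventAt {H : Type*} [NormedAddCommGroup H] [NormedSpace ℂ H]
    {T : H → H → Prop} {μ₀ : ℂ} {R₀ : H →L[ℂ] H} (h₀ : IsResolventAt T μ₀ R₀)
    (hc : IsCompactOperator R₀) : HasCompactResolvent T := by
  refine ⟨⟨μ₀, R₀, h₀⟩, fun μ R h => ?_⟩
  have : R = R₀ ∘L (ContinuousLinearMap.id ℂ H + (μ - μ₀) • R) := by
    ext f
    refine ((h₀ _ _).2 ?_).symm
    have := (h f (R f)).1 rfl
    rw [show f + μ • R f = (f + (μ - μ₀) • R f) + μ₀ • R f by module] at this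
    exact this
  rw [this]
  exact hc.comp_clm _

theorem isResolventAt_formResolvent {S S' M : Matrix (PhaseIdx N) (PhaseIdx N) ℝ}
    (hS : S' * S = 1) (hS' : S * S' = 1) (h : S.transpose * S = M) (c : ℂ) :
    IsResolventAt (HomogenizedOp M.toBlocks₂₂ ((-2 * Complex.I) • M.toBlocks₂₁.map Complex.ofReal)
      c M.toBlocks₁₁) (c - 1 - Complex.I * (M.toBlocks₂₁.trace : ℂ)) (formResolvent S') := by
  have h1 : M * S' = S.transpose := by rw [← h, Matrix.mul_assoc, hS', Matrix.mul_one]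
  have h2 : M.transpose = M := by rw [← h, Matrix.transpose_mul, Matrix.transpose_transpose]
  intro f φ
  have hR := homogenizedOp_formResolvent hS h1 h2 c f
  refine ⟨fun e => e ▸ hR, fun hφ => ?_⟩
  have hd := hR.sub hφ
  rw [add_sub_add_left_eq_sub, ← smul_sub] at hd
  -- The difference of two solutions is in the kernel of T - μ. Since the trace is real, Re(μ - c) =
  -- -1, and the energy estimate forces this difference to vanish.
  refine sub_eq_zero.1 (eq_zero_of_re_lt (inv_pos.2 ?_) (symbolCoercive_of_factor hS h) ?_ hd ?_)
  · positivity
  · intro j k; simp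
  · simp

/-! ### Hilbert bases of eigenvectors -/

/-- Distinct orthonormal vectors are at distance √2 ≥ 1, so the balls of radius 1/2 around them are
disjoint; a separable space contains only countably many disjoint open sets. -/
theorem Orthonormal.countable {ι H : Type*} [NormedAddCommGroup H] [InnerProductSpace ℂ H]
    [TopologicalSpace.SeparableSpace H] {v : ι → H} (hv : Orthonormal ℂ v) : Countable ι := by
  refine Pairwise.countable_of_isOpen_disjoint (s := fun i => Metric.ball (v i) (1 / 2))
    (fun i j hij => Metric.ball_disjoint_ball ?_) (fun _ => Metric.isOpen_ball)
    fun i => ⟨v i, Metric.mem_ball_self (by norm_num)⟩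
  have h := norm_sub_sq (𝕜 := ℂ) (v i) (v j)
  rw [hv.2 hij, hv.1, hv.1] at h
  rw [dist_eq_norm]
  simp only [map_zero, mul_zero, sub_zero] at h
  nlinarith [norm_nonneg (v i - v j)]

theorem Orthonormal.infinite_of_orthogonal_eq_bot {ι H : Type*} [NormedAddCommGroup H]
    [InnerProductSpace ℂ H] (hH : ¬FiniteDimensional ℂ H) {v : ι → H}
    (hsp : (Submodule.span ℂ (Set.range v))ᗮ = ⊥) : Infinite ι := by
  by_contra hι
  rw [not_infinite_iff_finite] at hι
  have := FiniteDimensional.span_of_finite ℂ (Set.finite_range v)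
  rw [Submodule.orthogonal_eq_bot_iff] at hsp
  rw [hsp] at this
  exact hH (Module.finite_def.2 (Module.Finite.iff_fg.1 this))

theorem exists_hilbertBasis_nat {ι H : Type*} [NormedAddCommGroup H] [InnerProductSpace ℂ H]
    [CompleteSpace H] [TopologicalSpace.SeparableSpace H] (hH : ¬FiniteDimensional ℂ H) {v : ι → H}
    (hv : Orthonormal ℂ v) (hsp : (Submodule.span ℂ (Set.range v))ᗮ = ⊥) :
    ∃ (b : HilbertBasis ℕ ℂ H) (e : ℕ → ι), ∀ k, b k = v (e k) := by
  have := hv.countable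
  have := Orthonormal.infinite_of_orthogonal_eq_bot hH hsp
  obtain ⟨e⟩ : Nonempty (ℕ ≃ ι) := by
    obtain ⟨h⟩ := nonempty_denumerable ι
    exact ⟨(Denumerable.eqv ι).symm⟩
  have hr : Set.range (v ∘ e) = Set.range v := e.surjective.range_comp v
  exact ⟨HilbertBasis.mkOfOrthogonalEqBot (hv.comp e e.injective) (by rw [hr, hsp]), e, fun k => by
    rw [HilbertBasis.coe_mkOfOrthogonalEqBot]; rfl⟩

/-- Choose a Hilbert basis in each eigenspace. Symmetry makes their union orthonormal and
compactness makes it total; separability and infinite dimension allow the indexing by ℕ. -/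
theorem exists_hilbertBasis_eigenvectors {H : Type*} [NormedAddCommGroup H] [InnerProductSpace ℂ H]
    [CompleteSpace H] [TopologicalSpace.SeparableSpace H] (hH : ¬FiniteDimensional ℂ H)
    {R : H →L[ℂ] H} (hc : IsCompactOperator R) (hs : (R : H →ₗ[ℂ] H).IsSymmetric) :
    ∃ b : HilbertBasis ℕ ℂ H, ∀ k, ∃ ν : ℂ, R (b k) = ν • b k := by
  have : ∀ μ : ℂ, CompleteSpace (Module.End.eigenspace (R : H →ₗ[ℂ] H) μ) := fun μ => by
    have : Module.End.eigenspace (R : H →ₗ[ℂ] H) μ =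
        (R - μ • ContinuousLinearMap.id ℂ H : H →L[ℂ] H).ker := by
      ext x
      simp [sub_eq_zero]
    rw [this]
    exact (ContinuousLinearMap.isClosed_ker _).completeSpace_coe
  choose w b hb using fun μ : ℂ =>
    exists_hilbertBasis ℂ (Module.End.eigenspace (R : H →ₗ[ℂ] H) μ)
  set v : (Σ μ, w μ) → H := fun a => (b a.1 a.2 : H) with hv
  have ho : Orthonormal ℂ v :=
    hs.orthogonalFamily_eigenspaces.orthonormal_sigma_orthonormal fun μ => (b μ).orthonormal
  have hsp : (Submodule.span ℂ (Set.range v))ᗮ = ⊥ := by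
    rw [← ContinuousLinearMap.orthogonalComplement_iSup_eigenspaces_eq_bot hc hs]
    refine le_antisymm (fun x hx => ?_) (Submodule.orthogonal_le (Submodule.span_le.2 ?_))
    · rw [← Submodule.iInf_orthogonal, Submodule.mem_iInf]
      intro μ
      -- A vector orthogonal to the chosen basis of an eigenspace has zero projection onto it,
      -- because all coordinates of the projection vanish.
      rw [← Submodule.orthogonalProjectionOnto_eq_zero_iff]
      apply (b μ).repr.injective
      ext i
      rw [(b μ).repr_apply_apply, map_zero]
      exact (Submodule.inner_orthogonalProjectionOnto_eq_of_mem_left _ _).trans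
        ((Submodule.mem_orthogonal _ _).1 hx _ (Submodule.subset_span ⟨⟨μ, i⟩, rfl⟩))
    · rintro _ ⟨a, rfl⟩
      exact (le_iSup (fun μ => Module.End.eigenspace (R : H →ₗ[ℂ] H) μ) a.1) (b a.1 a.2).2
  obtain ⟨B, e, he⟩ := exists_hilbertBasis_nat hH ho hsp
  refine ⟨B, fun k => ⟨(e k).1, ?_⟩⟩
  rw [he]
  exact Module.End.mem_eigenspace_iff.1 (b (e k).1 (e k).2).2

theorem not_finiteDimensional_L2Space (hN : 0 < N) : ¬FiniteDimensional ℂ (L2Space N) := by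
  intro hfin
  -- Unit balls with centres 4n along the first axis are disjoint, so their indicators form an
  -- infinite orthogonal family. Positive dimension provides the axis.
  set s : ℕ → Set (RN N) := fun n => Metric.ball ((4 * n : ℝ) • stdVec ⟨0, hN⟩) 1 with hs
  have hfs : ∀ n, volume (s n) ≠ ⊤ := fun n => measure_ball_lt_top.ne
  set u : ℕ → L2Space N := fun n => indicatorConstLp 2 measurableSet_ball (hfs n) (1 : ℂ) with hu
  have hd : ∀ m n, m ≠ n → Disjoint (s m) (s n) := fun m n hmn => by
    refine Metric.ball_disjoint_ball ?_
    have h1 : (1 : ℝ) ≤ |(m : ℝ) - n| := by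
      have : (1 : ℤ) ≤ |(m : ℤ) - n| := Int.one_le_abs (by omega)
      exact_mod_cast this
    rw [dist_eq_norm, ← sub_smul, norm_smul, stdVec, PiLp.norm_single, Real.norm_eq_abs,
      ← mul_sub, abs_mul]
    norm_num
    linarith
  have hne : ∀ n, u n ≠ 0 := fun n h => by
    have := norm_indicatorConstLp (p := 2) (hs := measurableSet_ball) (hμs := hfs n) (c := (1 : ℂ))
      (by norm_num) (by norm_num)
    rw [show indicatorConstLp 2 measurableSet_ball (hfs n) (1 : ℂ) = u n from rfl, h] at this
    have hpos : 0 < volume.real (s n) :=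
      ENNReal.toReal_pos (Metric.measure_ball_pos _ _ one_pos).ne' (hfs n)
    simp only [norm_zero, norm_one, one_mul] at this
    exact absurd this (Real.rpow_pos_of_pos hpos _).ne
  have ho : Pairwise fun m n => inner ℂ (u m) (u n) = 0 := fun m n hmn => by
    show inner ℂ (indicatorConstLp 2 measurableSet_ball (hfs m) (1 : ℂ))
      (indicatorConstLp 2 measurableSet_ball (hfs n) (1 : ℂ)) = 0
    rw [L2.inner_indicatorConstLp_indicatorConstLp, (hd m n hmn).inter_eq]
    simp
  have hli := linearIndependent_of_ne_zero_of_inner_eq_zero hne ho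
  exact not_finite_iff_infinite.2 inferInstance hli.finite

theorem separableSpace_L2Space (N : ℕ) : TopologicalSpace.SeparableSpace (L2Space N) := by
  have : Fact ((2 : ℝ≥0∞) ≠ ⊤) := ⟨by norm_num⟩
  infer_instance

/-! ### The homogenized coefficients -/

/-- The coefficient matrix of the quadratic form in `(z φ, -i∇φ)`: the Hessian in the variables
`(x, 2πθ)`, halved. -/
def phaseMatrix (H : Matrix (PhaseIdx N) (PhaseIdx N) ℝ) : Matrix (PhaseIdx N) (PhaseIdx N) ℝ :=
  Matrix.of fun a b => (1 / 2 : ℝ) * (Sum.elim (fun _ => 1) (fun _ => 1 / (2 * π)) a * H a b *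
    Sum.elim (fun _ => 1) (fun _ => 1 / (2 * π)) b)

/-- Passing from θ to 2πθ is a congruence by an invertible diagonal matrix, which preserves
positivity. -/
theorem posDef_phaseMatrix {H : Matrix (PhaseIdx N) (PhaseIdx N) ℝ} (hH : H.PosDef) :
    (phaseMatrix H).PosDef := by
  set d : PhaseIdx N → ℝ := Sum.elim (fun _ => 1) (fun _ => 1 / (2 * π)) with hd
  have hd0 : ∀ a, d a ≠ 0 := by
    rintro (a | a)
    · exact one_ne_zero
    · exact (by positivity : (1 / (2 * π) : ℝ) ≠ 0)
  have hinj : Function.Injective (Matrix.diagonal d).mulVec := fun v w h => by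
    funext a
    have := congrFun h a
    rw [Matrix.mulVec_diagonal, Matrix.mulVec_diagonal] at this
    exact mul_left_cancel₀ (hd0 a) this
  have h1 := (hH.conjTranspose_mul_mul_same hinj).smul (by norm_num : (0 : ℝ) < 1 / 2)
  convert h1 using 1
  ext a b
  simp [phaseMatrix, hd]

theorem phaseMatrix_toBlocks₂₁ (H : Matrix (PhaseIdx N) (PhaseIdx N) ℝ) :
    (-2 * Complex.I) • (phaseMatrix H).toBlocks₂₁.map Complex.ofReal =
      (1 / (2 * Complex.I * π)) • H.toBlocks₂₁.map Complex.ofReal := by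
  have hπ : (π : ℂ) ≠ 0 := Complex.ofReal_ne_zero.2 pi_ne_zero
  ext j k
  simp only [phaseMatrix, Matrix.toBlocks₂₁, Matrix.smul_apply, Matrix.map_apply, Matrix.of_apply,
    Sum.elim_inl, Sum.elim_inr, smul_eq_mul]
  push_cast
  field_simp
  linear_combination (-(H (Sum.inr j) (Sum.inl k) : ℂ)) * Complex.I_sq

theorem phaseMatrix_toBlocks₁₁ (H : Matrix (PhaseIdx N) (PhaseIdx N) ℝ) :
    (phaseMatrix H).toBlocks₁₁ = (1 / 2 : ℝ) • H.toBlocks₁₁ := by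
  ext j k
  simp [phaseMatrix, Matrix.toBlocks₁₁]

theorem phaseMatrix_toBlocks₂₂ (H : Matrix (PhaseIdx N) (PhaseIdx N) ℝ) :
    (phaseMatrix H).toBlocks₂₂ = (1 / (8 * π ^ 2)) • H.toBlocks₂₂ := by
  ext j k
  simp only [phaseMatrix, Matrix.toBlocks₂₂, Matrix.smul_apply, Matrix.of_apply, Sum.elim_inr,
    smul_eq_mul]
  field_simp
  ring

/-- The operator with the coefficients of a positive definite phase space matrix has a compact
resolvent, a Hilbert basis of eigenfunctions, and exponentially decaying eigenfunctions. -/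
theorem spectral_properties_of_posDef (hN : 0 < N) {M : Matrix (PhaseIdx N) (PhaseIdx N) ℝ}
    (hM : M.PosDef) (c : ℂ) {T : L2Space N → L2Space N → Prop}
    (hT : T = HomogenizedOp M.toBlocks₂₂ ((-2 * Complex.I) • M.toBlocks₂₁.map Complex.ofReal)
      c M.toBlocks₁₁) :
    HasCompactResolvent T ∧
    (∃ φ : HilbertBasis ℕ ℂ (L2Space N), ∀ k : ℕ, ∃ σ : ℂ, IsEigenfunctionOf T σ (φ k)) ∧
    (∀ (σ : ℂ) (φ : L2Space N), IsEigenfunctionOf T σ φ →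
      ∃ γ : ℝ, 0 < γ ∧
        MemLp (fun z : RN N => (Real.exp (γ * ‖z‖) : ℂ) * φ z) 2 volume ∧
        ∃ g : Fin N → L2Space N, IsWeakGradient φ g ∧
          ∀ j, MemLp (fun z : RN N => (Real.exp (γ * ‖z‖) : ℂ) * g j z) 2 volume) := by
  obtain ⟨S, S', h1, h2, h3⟩ := exists_factor hM
  have hR := isResolventAt_formResolvent h1 h2 h3 c
  rw [← hT] at hR
  refine ⟨hasCompactResolvent_of_isResolventAt hR (isCompactOperator_formResolvent S'), ?_, ?_⟩
  · have := separableSpace_L2Space N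
    obtain ⟨b, hb⟩ := exists_hilbertBasis_eigenvectors (not_finiteDimensional_L2Space hN)
      (isCompactOperator_formResolvent S') (formResolvent_isSymmetric S')
    refine ⟨b, fun k => ?_⟩
    have hb0 : b k ≠ 0 := b.orthonormal.ne_zero k
    obtain ⟨ν, hν⟩ := hb k
    -- If ν were 0, the resolvent would send b_k to 0, so T would map 0 to b_k, and b_k would
    -- vanish.
    have hν0 : ν ≠ 0 := fun h => hb0 <| by
      have := (hR _ _).1 hν
      rw [h, zero_smul, smul_zero, add_zero, hT] at this
      exact this.eq_zero
    -- Rescaling the eigenvector relation R b = νb exhibits b as an eigenfunction of T with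
    -- eigenvalue ν⁻¹ + μ.
    have hr : formResolvent S' (ν⁻¹ • b k) = b k := by
      rw [map_smul, hν, smul_smul, inv_mul_cancel₀ hν0, one_smul]
    have h := (hR _ _).1 hr
    rw [← add_smul] at h
    exact ⟨_, hb0, h⟩
  · rintro σ φ ⟨-, hφ⟩
    rw [hT] at hφ
    refine exists_exponential_decay (inv_pos.2 ?_) (symbolCoercive_of_factor h1 h3) ?_ hφ
    · positivity
    · intro j k; simp

end

/-! ### Application to the Hessian of the Bloch band. -/

theorem proposition3p5 (N : ℕ) (hN : 0 < N) (K : CellCoefficients N) (n : ℕ) (hn : 1 ≤ n)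
    (xn θn : RN N)
    (hsimple : K.IsSimpleAt n xn θn)
    (hcrit : HasFDerivAt (K.blochBand n) (0 : RN N × RN N →L[ℝ] ℝ) (xn, θn))
    (hA : ∀ i j, ContDiffAt ℝ 2 (K.A i j) xn)
    (hc : ContDiffAt ℝ 2 K.c xn)
    (ψ : RN N → L2Torus N) (hψ : K.IsBlochBranch n xn θn ψ)
    (hHess : (K.blochHessian n xn θn).PosDef)
    (T : L2Space N → L2Space N → Prop)
    (hT : T = HomogenizedOp (K.Astar n xn θn) (K.Bstar n xn θn) (K.cstar xn θn ψ)
      (K.Dstar n xn θn)) :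
    HasCompactResolvent T ∧
    (∃ φ : HilbertBasis ℕ ℂ (L2Space N), ∀ k : ℕ, ∃ σ : ℂ, IsEigenfunctionOf T σ (φ k)) ∧
    (∀ (σ : ℂ) (φ : L2Space N), IsEigenfunctionOf T σ φ →
      ∃ γ : ℝ, 0 < γ ∧
        MemLp (fun z : RN N => (Real.exp (γ * ‖z‖) : ℂ) * φ z) 2 volume ∧
        ∃ g : Fin N → L2Space N, IsWeakGradient φ g ∧
          ∀ j, MemLp (fun z : RN N => (Real.exp (γ * ‖z‖) : ℂ) * g j z) 2 volume) := by
  refine spectral_properties_of_posDef hN (posDef_phaseMatrix hHess) (K.cstar xn θn ψ) ?_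
  rw [phaseMatrix_toBlocks₁₁, phaseMatrix_toBlocks₂₁, phaseMatrix_toBlocks₂₂]
  exact hT
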